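/- Let $n$ be an even non-negative integer and let $\frac12 \le p \le 1$. For a partition $\lambda$ of $n$ let $\chi_\lambda$ be the character of the irreducible complex representation of the symmetric group $S_n$ indexed by $\lambda$ (with $[n]$ indexing the trivial representation), let $d_\lambda$ be its dimension, and let \[ \psi_\lambda = \sum_{s=0}^{n/2} p^{n/2-s}(1-p)^s \binom{n/2}{s} \frac{\chi_\lambda(1^{n-2s},2^s)}{d_\lambda}, \] where $\chi_\lambda(1^{n-2s},2^s)$ is the value of $\chi_\lambda$ at a permutation with $s$ two-cycles and $n-2s$ fixed points. (This is the eigenvalue at $\lambda$ of the involution walk on $S_n$, whose steps are obtained from a uniformly random fixed point free involution by discarding each of its $n/2$ two-cycles independently with probability $p$.) Let $0 \le i \le n/2$. Then for every partition $\lambda$ of $n$ with largest part $\lambda_1 = n-i$, \[ \psi_\lambda \le \psi_{[n-i,i]}, \] where $[n-i,i]$ is the partition of $n$ with parts $n-i$ and $i$ (just $[n]$ if $i=0$). -/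

import Mathlib

open scoped ComplexOrder

namespace InvolutionWalk

noncomputable section

/-- The two-row Young diagram `[a, b]` with rows of length `a ≥ b` (`b = 0` gives the one-row
diagram `[a]`). -/
def twoRow (a b : ℕ) (h : b ≤ a) : YoungDiagram :=
  YoungDiagram.ofRowLens [a, b] (by simpa [List.sortedGE_iff_pairwise] using h)

/-- A fixed bijective filling of the cells of `μ` (a Young tableau of shape `μ`) by
`0, …, |μ| - 1`: entry `k` stands in the cell (row, column) `tableau μ k`. -/
def tableau (μ : YoungDiagram) : Fin μ.card ≃ μ.cells :=
  μ.cells.equivFin.symm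

/-- The row group: permutations of the entries that keep every entry in its row. -/
def rowGroup (μ : YoungDiagram) : Subgroup (Equiv.Perm (Fin μ.card)) where
  carrier := {g | ∀ k, (tableau μ (g k)).1.1 = (tableau μ k).1.1}
  mul_mem' := fun {a b} ha hb k => (ha (b k)).trans (hb k)
  one_mem' := fun _ => rfl
  inv_mem' := fun {a} ha k => by simpa using (ha (a⁻¹ k)).symm

/-- The column group: permutations of the entries that keep every entry in its column. -/
def colGroup (μ : YoungDiagram) : Subgroup (Equiv.Perm (Fin μ.card)) where
  carrier := {g | ∀ k, (tableau μ (g k)).1.2 = (tableau μ k).1.2}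
  mul_mem' := fun {a b} ha hb k => (ha (b k)).trans (hb k)
  one_mem' := fun _ => rfl
  inv_mem' := fun {a} ha k => by simpa using (ha (a⁻¹ k)).symm

open Classical in
/-- The Young symmetrizer
`c_μ = (∑ g in the row group, g) * (∑ h in the column group, sign h • h)` in `ℂ[S_n]`, `n = |μ|`. -/
def youngSymmetrizer (μ : YoungDiagram) : MonoidAlgebra ℂ (Equiv.Perm (Fin μ.card)) :=
  (∑ g with g ∈ rowGroup μ, MonoidAlgebra.of ℂ _ g) *
    (∑ h with h ∈ colGroup μ,
      ((Equiv.Perm.sign h : ℤ) : ℂ) • MonoidAlgebra.of ℂ (Equiv.Perm (Fin μ.card)) h)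

/-- The Specht module of `μ`: the left ideal `ℂ[S_n] c_μ`. -/
abbrev spechtModule (μ : YoungDiagram) : Ideal (MonoidAlgebra ℂ (Equiv.Perm (Fin μ.card))) :=
  Ideal.span {youngSymmetrizer μ}

/-- The irreducible representation of `S_n` indexed by the partition `μ` of `n`: the group acts on
the Specht module by left multiplication. -/
def spechtRep (μ : YoungDiagram) :
    Representation ℂ (Equiv.Perm (Fin μ.card)) (spechtModule μ) :=
  ((Algebra.lsmul ℂ ℂ (spechtModule μ) :
      MonoidAlgebra ℂ (Equiv.Perm (Fin μ.card)) →ₐ[ℂ] Module.End ℂ (spechtModule μ)) :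
      MonoidAlgebra ℂ (Equiv.Perm (Fin μ.card)) →* Module.End ℂ (spechtModule μ)).comp
    (MonoidAlgebra.of ℂ (Equiv.Perm (Fin μ.card)))

/-- The involution `(0 1)(2 3)⋯(2s-2 2s-1)` of `Fin n`, a representative of the conjugacy class
`(1^{n-2s}, 2^s)` when `2 * s ≤ n`. -/
def pairSwaps (n s : ℕ) : Equiv.Perm (Fin n) :=
  ((List.range s).map fun j =>
    if h : 2 * j + 1 < n then Equiv.swap (⟨2 * j, by omega⟩ : Fin n) ⟨2 * j + 1, h⟩ else 1).prod

/-- The eigenvalue of the involution walk on `S_n` (`n = |μ|` even) at the partition `μ`: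
`∑_{s=0}^{n/2} p^{n/2-s} (1-p)^s (n/2 choose s) χ_μ(1^{n-2s}, 2^s) / d_μ`. -/
def eigenvalue (p : ℝ) (μ : YoungDiagram) : ℂ :=
  ∑ s ∈ Finset.range (μ.card / 2 + 1),
    (p : ℂ) ^ (μ.card / 2 - s) * (1 - (p : ℂ)) ^ s * ((μ.card / 2).choose s : ℂ) *
      ((spechtRep μ).character (pairSwaps μ.card s) / (Module.finrank ℂ (spechtModule μ) : ℂ))

end

end InvolutionWalk

/-! Write n = 2m and sum the weighted steps of the walk over all n! labellings of the m pairs. On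
the Specht module of μ this operator has trace n! d_μ ψ_μ (`eigenvalue_eq_trace`), so bounding each
of its eigenvalues bounds ψ_μ; irreducibility and Schur's lemma are not needed.

Let the first row have length n - i. Recording only where the i entries below it go embeds the
module equivariantly in the functions of injective i-tuples whose sum over any one coordinate
vanishes (`tupleMap_injective`, `tupleMap_mem_harmonic`). On such functions the operator acts as an
element of the group algebra of S_i permuting coordinates: by `sum_extending_eq`, coordinates sent
to new positions can be pulled back onto the old ones, one sign change each. With a single lower row
the functions are symmetric, so the operator is the scalar `symEigenvalue`. The claim is thus that
symmetric functions have the largest eigenvalue.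

For an eigenspace W with eigenvalue ψ, a trace writes (`symEigenvalue` - ψ) dim W as a signed sum of
terms dim W - χ_W(θ). Splitting p = (2p - 1) + (1 - p), with both parts nonnegative, replaces the
random set of kept pairs by the unweighted subsets of a set D (`sum_weight_eq`). For fixed D and
fixed positions of the tuple, averaging turns characters into dimensions of invariants. Up to a
positive factor the contribution is the sum over b of (-1)^b C(N-b, N-s) (dim W - d_b). Here N = 2m
- i, s counts the pairs of D with exactly one occupied member, and d_b is the dimension of the
vectors invariant under exchanges inside the other pairs and under permutations of b of the s single
coordinates.

The sequence d is convex from b = 1 on, and for s < N the binomials decrease convexly to zero, so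
the sum is nonnegative (`alternating_sum_convex_concave_nonneg`). The case s = N forces i = m, D
everything, and one occupied member in each pair. Such contributions may be negative, but positions
filling exactly one whole pair outweigh them (`neg_le_gapTerm`, `le_gapTerm_of_pair`,
`card_transversals_le`). -/

namespace InvolutionWalk

noncomputable section

open Finset Function Equiv

/-! ### Harmonic functions of tuples and their averages over bijections. -/

section Harmonic

set_option linter.unusedSectionVars false

variable {I X P : Type*} [Fintype I] [DecidableEq I] [Fintype X] [DecidableEq X]
  [Fintype P] [DecidableEq P]

/-- Functions on `I`-tuples of distinct elements of `X` (extended by zero to all tuples) all of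
whose sums over one coordinate vanish. -/
def harmonic (I X : Type*) [DecidableEq I] [Fintype X] : Submodule ℂ ((I → X) → ℂ) where
  carrier := {F | (∀ a, ¬ Injective a → F a = 0) ∧ ∀ a j, ∑ x, F (update a j x) = 0}
  add_mem' := fun {F G} hF hG =>
    ⟨fun a ha => by simp [hF.1 a ha, hG.1 a ha], fun a j => by
      simp [sum_add_distrib, hF.2 a j, hG.2 a j]⟩
  zero_mem' := ⟨fun _ _ => rfl, fun _ _ => by simp⟩
  smul_mem' := fun c F hF =>
    ⟨fun a ha => by simp [hF.1 a ha], fun a j => by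
      simp only [Pi.smul_apply, ← smul_sum, hF.2 a j, smul_zero]⟩

/-- The indices `j` whose entry `z j` lies outside the range of `a'`. -/
def outside (a' z : I → P) : Finset I := {j | ∀ k, a' k ≠ z j}

/-- The bijections `g` with `g ∘ a' = a`. -/
def extensions (a' : I → P) (a : I → X) : Finset (P ≃ X) := {g | ∀ k, g (a' k) = a k}

/-- The permutations `θ` such that `a' ∘ θ` agrees with `z` wherever `z` takes values in the
range of `a'`. -/
def completions (a' z : I → P) : Finset (Perm I) :=
  {θ | ∀ j, j ∉ outside a' z → a' (θ j) = z j}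

lemma mem_extensions {a' : I → P} {a : I → X} {g : P ≃ X} :
    g ∈ extensions a' a ↔ ∀ k, g (a' k) = a k := by
  simp [extensions]

lemma mem_outside {a' z : I → P} {j : I} : j ∈ outside a' z ↔ ∀ k, a' k ≠ z j := by
  simp [outside]

/-- The number of bijections extending a given injection. -/
lemma card_equiv_extending (hc : Fintype.card P = Fintype.card X) {a : I → X} {a' : I → P}
    (ha : Injective a) (ha' : Injective a') :
    #(extensions a' a) = (Fintype.card P - Fintype.card I).factorial := by
  classical
  obtain ⟨g₀, hg₀⟩ : ∃ g₀ : P ≃ X, ∀ k, g₀ (a' k) = a k := by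
    let e : {x // x ∈ Set.range a'} ≃ {x // x ∈ Set.range a} :=
      (Equiv.ofInjective a' ha').symm.trans (Equiv.ofInjective a ha)
    let c : P ≃ X := Fintype.equivOfCardEq hc
    let e' : {x : P // x ∈ Set.range a'} ≃ {x : P // c x ∈ Set.range a} :=
      e.trans (c.subtypeEquiv (p := fun x => c x ∈ Set.range a) (fun _ => Iff.rfl)).symm
    refine ⟨e'.extendSubtype.trans c, fun k => ?_⟩
    have := e'.extendSubtype_apply_of_mem (a' k) ⟨k, rfl⟩
    simp only [Equiv.trans_apply, this, e', e]
    have h3 : (Equiv.ofInjective a' ha').symm ⟨a' k, ⟨k, rfl⟩⟩ = k :=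
      Equiv.ofInjective_symm_apply ha' k
    simp [h3, Equiv.subtypeEquiv]
  have h1 : #(extensions a' a) = #{h : Perm P | ∀ x, ¬ (x ∉ Set.range a') → h x = x} := by
    refine card_bij' (fun g _ => g.trans g₀.symm) (fun h _ => h.trans g₀) ?_ ?_ ?_ ?_
    · intro g hg
      simp only [mem_extensions, mem_filter, mem_univ, true_and, not_not] at hg ⊢
      rintro _ ⟨k, rfl⟩
      simp [hg k, ← hg₀]
    · intro h hh
      simp only [mem_extensions, mem_filter, mem_univ, true_and, not_not] at hh ⊢
      intro k
      simp [hh (a' k) ⟨k, rfl⟩, hg₀]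
    · intro g _; ext; simp
    · intro g _; ext; simp
  rw [h1, ← Fintype.card_subtype,
    ← Fintype.card_congr (Perm.subtypeEquivSubtypePerm (fun x : P => x ∉ Set.range a')),
    Fintype.card_perm, Fintype.card_subtype_compl]
  congr 2
  exact (Fintype.card_congr (Equiv.ofInjective a' ha')).symm

lemma outside_card_le {a' z : I → P} (ha' : Injective a') (hz : Injective z) :
    #(outside a' z) + Fintype.card I ≤ Fintype.card P := by
  have h : Disjoint ((outside a' z).image z) (univ.image a') := by
    rw [disjoint_left]
    intro x hx hx'
    simp only [mem_image, mem_univ, true_and] at hx hx'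
    obtain ⟨j, hj, rfl⟩ := hx
    obtain ⟨k, hk⟩ := hx'
    exact mem_outside.1 hj k hk
  have := card_le_univ ((outside a' z).image z ∪ univ.image a')
  rwa [card_union_of_disjoint h, card_image_of_injective _ hz, card_image_of_injective _ ha',
    card_univ] at this

/-- Replacing `z j` by `v` is composition with the transposition of the two, which fixes the range
of `a'` and so permutes the bijections being summed over. -/
lemma sum_extending_update {F : (I → X) → ℂ} {a : I → X} {a' z : I → P} (hz : Injective z)
    {j : I} (hj : j ∈ outside a' z) {v : P} (hv : ∀ k, a' k ≠ v) (hv' : ∀ l, l ≠ j → z l ≠ v) :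
    ∑ g ∈ extensions a' a, F (g ∘ update z j v) = ∑ g ∈ extensions a' a, F (g ∘ z) := by
  have hs : update z j v = swap (z j) v ∘ z := by
    funext l
    by_cases h : l = j
    · subst h; simp
    · simp [h, swap_apply_of_ne_of_ne (hz.ne h) (hv' l h)]
  have ha : ∀ k, swap (z j) v (a' k) = a' k := fun k =>
    swap_apply_of_ne_of_ne (mem_outside.1 hj k) (hv k)
  refine sum_nbij' (fun g => (swap (z j) v).trans g) (fun g => (swap (z j) v).trans g) ?_ ?_ ?_ ?_ ?_
  · intro g hg
    rw [mem_extensions] at hg ⊢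
    intro k; simp [ha, hg]
  · intro g hg
    rw [mem_extensions] at hg ⊢
    intro k; simp [ha, hg]
  · intro g _; ext; simp
  · intro g _; ext; simp
  · intro g _
    rw [hs]; rfl

lemma card_free_values {a' z : I → P} (ha' : Injective a') (hz : Injective z)
    {j : I} (hj : j ∈ outside a' z) :
    #{v : P | (∀ k, a' k ≠ v) ∧ ∀ l, l ≠ j → z l ≠ v} =
      Fintype.card P - Fintype.card I - #(outside a' z) + 1 := by
  have h : ({v : P | (∀ k, a' k ≠ v) ∧ ∀ l, l ≠ j → z l ≠ v} : Finset P) =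
      (univ \ univ.image a') \ (((outside a' z).erase j).image z) := by
    ext v
    simp only [mem_filter, mem_univ, true_and, mem_sdiff, mem_image, mem_erase, not_exists,
      mem_outside, not_and]
    constructor
    · rintro ⟨h1, h2⟩
      exact ⟨h1, fun l hl => h2 l hl.1⟩
    · rintro ⟨h1, h2⟩
      exact ⟨h1, fun l hl hlv => h2 l ⟨hl, fun k hk => h1 k (hk.trans hlv)⟩ hlv⟩
  have hsub : ((outside a' z).erase j).image z ⊆ univ \ univ.image a' := by
    intro v hv
    simp only [mem_image, mem_erase, mem_outside] at hv
    obtain ⟨l, ⟨_, h2⟩, rfl⟩ := hv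
    simpa using h2
  have := outside_card_le ha' hz
  have hpos : 0 < #(outside a' z) := card_pos.2 ⟨j, hj⟩
  rw [h, card_sdiff_of_subset hsub, card_image_of_injective _ hz, card_erase_of_mem hj,
    card_univ_sdiff, card_image_of_injective _ ha', card_univ]
  omega

lemma outside_update {a' z : I → P} {j k : I} (hj : j ∈ outside a' z) :
    outside a' (update z j (a' k)) = (outside a' z).erase j := by
  ext l
  by_cases h : l = j
  · subst h; simp [mem_outside]
  · simp [mem_outside, h]

/-- Sorts completions by `k = θ j`. No completion has `θ j = k` if `a' k` is already a value `z l`,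
since then also `θ l = k`. -/
lemma sum_completions_eq {a' z : I → P} (ha' : Injective a') {j : I} (hj : j ∈ outside a' z)
    (f : Perm I → ℂ) :
    ∑ θ ∈ completions a' z, f θ =
      ∑ k with ∀ l, z l ≠ a' k, ∑ θ ∈ completions a' (update z j (a' k)), f θ := by
  rw [← sum_fiberwise (completions a' z) (fun θ => θ j) f, sum_filter]
  refine sum_congr rfl fun k _ => ?_
  split_ifs with hk
  · refine sum_congr ?_ fun _ _ => rfl
    ext θ
    simp only [completions, mem_filter, mem_univ, true_and, outside_update hj, mem_erase, not_and]
    constructor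
    · rintro ⟨h1, rfl⟩ l hl
      by_cases h : l = j
      · subst h; simp
      · simpa [h] using h1 l (hl h)
    · intro h
      refine ⟨fun l hl => ?_, ?_⟩
      · have hlj : l ≠ j := fun e => hl (e ▸ hj)
        simpa [hlj] using h l (fun _ => hl)
      · have := h j (fun h => absurd rfl h)
        exact ha' (by simpa using this)
  · refine sum_eq_zero fun θ hθ => absurd ?_ hk
    simp only [completions, mem_filter, mem_univ, true_and] at hθ
    obtain ⟨h1, rfl⟩ := hθ
    intro l hl
    have hl' : l ∉ outside a' z := fun h => mem_outside.1 h _ hl.symm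
    have := h1 l hl'
    rw [hl] at this
    exact hl' ((θ.injective (ha' this)) ▸ hj)

/-- Averaging a harmonic function over all bijections with prescribed values on the range
of `a'`. -/
theorem sum_extending_eq (hc : Fintype.card P = Fintype.card X) {F : (I → X) → ℂ}
    (hF : F ∈ harmonic I X) (a : I → X) {a' : I → P} (ha' : Injective a') (z : I → P)
    (hz : Injective z) :
    ∑ g ∈ extensions a' a, F (g ∘ z) =
      (-1) ^ #(outside a' z) *
        ((Fintype.card P - Fintype.card I - #(outside a' z)).factorial : ℂ) *
        ∑ θ ∈ completions a' z, F (a ∘ θ) := by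
  -- Each step moves one outside value of `z` into the range of `a'`.
  induction hb : #(outside a' z) generalizing z with
  | zero =>
    have hB : outside a' z = ∅ := card_eq_zero.1 hb
    have hex : ∀ j, ∃ k, a' k = z j := fun j => by
      have : j ∉ outside a' z := by simp [hB]
      simpa [mem_outside] using this
    choose t ht using hex
    have hti : Injective t := fun x y h => hz (by rw [← ht, ← ht, h])
    let θ₀ : Perm I := Equiv.ofBijective t (Finite.injective_iff_bijective.1 hti)
    have hcomp : completions a' z = {θ₀} := by
      ext θ
      simp only [completions, hB, mem_filter, mem_univ, true_and, notMem_empty, not_false_eq_true,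
        forall_const, mem_singleton]
      constructor
      · intro h; ext j; exact ha' ((h j).trans (ht j).symm)
      · rintro rfl j; exact ht j
    have hzz : z = a' ∘ θ₀ := funext fun j => (ht j).symm
    rw [hcomp, sum_singleton]
    have : ∀ g ∈ extensions a' a, F (g ∘ z) = F (a ∘ θ₀) := by
      intro g hg
      rw [hzz, ← Function.comp_assoc, show g ∘ a' = a from funext (mem_extensions.1 hg)]
    rw [sum_congr rfl this, sum_const]
    by_cases ha : Injective a
    · rw [card_equiv_extending hc ha ha']; simp
    · rw [hF.1 _ (fun h => ha ((Injective.of_comp_iff' a θ₀.bijective).1 h))]; simp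
  | succ b ih =>
    obtain ⟨j, hj⟩ : (outside a' z).Nonempty := card_pos.1 (by omega)
    have hle := outside_card_le ha' hz
    set T : (I → P) → ℂ := fun z => ∑ g ∈ extensions a' a, F (g ∘ z) with hT
    have hT0 : ∀ y, ¬ Injective y → T y = 0 := fun y hy => sum_eq_zero fun g _ =>
      hF.1 _ fun h => hy (Injective.of_comp h)
    have hsum : ∑ v, T (update z j v) = 0 := by
      rw [hT]; dsimp only
      rw [sum_comm]
      refine sum_eq_zero fun g _ => ?_
      rw [← hF.2 (g ∘ z) j, ← Equiv.sum_comp g]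
      refine sum_congr rfl fun v _ => ?_
      rw [Function.comp_update]
    -- Outside the range of `a'`, a value already taken by another coordinate contributes zero, and
    -- every free value contributes `T z`. The number of free values supplies the next factor of the
    -- factorial.
    have hsplit : ∑ v, T (update z j v) = ∑ k, T (update z j (a' k)) +
        ((Fintype.card P - Fintype.card I - (b + 1) + 1 : ℕ) : ℂ) * T z := by
      rw [← sum_filter_add_sum_filter_not univ (fun v => v ∈ univ.image a')]
      congr 1
      · rw [show ({v ∈ univ | v ∈ univ.image a'} : Finset P) = univ.image a' by ext; simp,
          sum_image ha'.injOn]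
      · rw [← hb, ← card_free_values ha' hz hj, ← nsmul_eq_mul, ← sum_const]
        symm
        refine sum_subset_zero_on_sdiff ?_ ?_ ?_
        · intro v; simp +contextual
        · intro v hv
          simp only [mem_image, mem_univ, true_and, not_exists, mem_sdiff, mem_filter,
            not_and, not_forall] at hv
          obtain ⟨l, hl, hlv⟩ := hv.2 hv.1
          refine hT0 _ fun h => hl (h ?_)
          rw [update_self, update_of_ne hl]; exact not_not.1 hlv
        · intro v hv
          simp only [mem_filter, mem_univ, true_and] at hv
          exact (sum_extending_update hz hj hv.1 hv.2).symm
    have hrec : ∑ k, T (update z j (a' k)) =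
        (-1) ^ b * ((Fintype.card P - Fintype.card I - b).factorial : ℂ) *
          ∑ θ ∈ completions a' z, F (a ∘ θ) := by
      rw [sum_completions_eq ha' hj, mul_sum, sum_filter]
      refine sum_congr rfl fun k _ => ?_
      split_ifs with hk
      · refine ih _ ?_ ?_
        · intro x y hxy
          by_cases hx : x = j <;> by_cases hy : y = j
          · rw [hx, hy]
          · subst hx; rw [update_self, update_of_ne hy] at hxy; exact absurd hxy.symm (hk y)
          · subst hy; rw [update_self, update_of_ne hx] at hxy; exact absurd hxy (hk x)
          · rw [update_of_ne hx, update_of_ne hy] at hxy; exact hz hxy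
        · rw [outside_update hj, card_erase_of_mem hj, hb]; rfl
      · push Not at hk
        obtain ⟨l, hl⟩ := hk
        have hlj : l ≠ j := fun e => mem_outside.1 hj k (e ▸ hl.symm)
        refine hT0 _ fun h => hlj (h ?_)
        rw [update_self, update_of_ne hlj, hl]
    rw [hsum, hrec] at hsplit
    obtain ⟨c, hc'⟩ : ∃ c, Fintype.card P - Fintype.card I = c + (b + 1) :=
      ⟨Fintype.card P - Fintype.card I - (b + 1), by omega⟩
    rw [hc', show c + (b + 1) - b = c + 1 by omega, Nat.add_sub_cancel, Nat.factorial_succ]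
      at hsplit
    rw [hc', Nat.add_sub_cancel]
    have hne : ((c : ℂ) + 1) ≠ 0 := by exact_mod_cast Nat.succ_ne_zero c
    apply mul_left_cancel₀ hne
    push_cast at hsplit
    linear_combination -hsplit

end Harmonic

/-! ### The averaged walk as an element of the group algebra of the coordinate permutations. -/

section Matching

set_option linter.unusedSectionVars false

variable {I X : Type*} [Fintype I] [DecidableEq I] [Fintype X] [DecidableEq X] {m : ℕ}

/-- The involution of `Fin m × Bool` exchanging the two members of each pair in `ε`. -/
def flip (ε : Finset (Fin m)) : Perm (Fin m × Bool) :=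
  Involutive.toPerm (fun x => (x.1, if x.1 ∈ ε then !x.2 else x.2)) fun x => by
    by_cases h : x.1 ∈ ε <;> simp [h]

lemma flip_apply (ε : Finset (Fin m)) (x : Fin m × Bool) :
    flip ε x = (x.1, if x.1 ∈ ε then !x.2 else x.2) := rfl

lemma flip_flip (ε δ : Finset (Fin m)) (x : Fin m × Bool) :
    flip ε (flip δ x) = flip (symmDiff ε δ) x := by
  by_cases h : x.1 ∈ ε <;> by_cases h' : x.1 ∈ δ <;> simp [flip_apply, mem_symmDiff, h, h']

/-- The weighted sum of the conjugates of the involutions `flip ε`, acting on functions of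
`I`-tuples. -/
def avgOp (w : Finset (Fin m) → ℂ) : ((I → X) → ℂ) →ₗ[ℂ] ((I → X) → ℂ) where
  toFun F a := ∑ g : Fin m × Bool ≃ X, ∑ ε, w ε * F (g ∘ flip ε ∘ g.symm ∘ a)
  map_add' F G := by funext a; simp [mul_add, sum_add_distrib]
  map_smul' c F := by funext a; simp [mul_sum, mul_left_comm]

lemma avgOp_apply (w : Finset (Fin m) → ℂ) (F : (I → X) → ℂ) (a : I → X) :
    avgOp w F a = ∑ g : Fin m × Bool ≃ X, ∑ ε, w ε * F (g ∘ flip ε ∘ g.symm ∘ a) := rfl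

/-- The signed weight with which `flip ε`, seen from the positions `a'`, enters `avgOp`. -/
def coef (w : Finset (Fin m) → ℂ) (a' : I → Fin m × Bool) (ε : Finset (Fin m)) : ℂ :=
  w ε * ((-1) ^ #(outside a' (flip ε ∘ a')) *
    ((2 * m - Fintype.card I - #(outside a' (flip ε ∘ a'))).factorial : ℂ))

/-- Sorting the labellings by the positions `a' = g.symm ∘ a` leaves, for each `ε`, the sum
evaluated in `sum_extending_eq` with `z = flip ε ∘ a'`. The resulting coefficients do not depend on
`a`. -/
theorem avgOp_eq_sum_perm (hc : Fintype.card X = 2 * m) (w : Finset (Fin m) → ℂ)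
    {F : (I → X) → ℂ} (hF : F ∈ harmonic I X) (a : I → X) :
    avgOp w F a = ∑ a' : I → Fin m × Bool with Injective a', ∑ ε, coef w a' ε *
      ∑ θ ∈ completions a' (flip ε ∘ a'), F (a ∘ θ) := by
  classical
  by_cases ha : Injective a
  swap
  · rw [avgOp_apply]
    have h1 : ∀ θ : Perm I, F (a ∘ θ) = 0 := fun θ =>
      hF.1 _ fun h => ha ((Injective.of_comp_iff' a θ.bijective).1 h)
    have h2 : ∀ (g : Fin m × Bool ≃ X) (ε : Finset (Fin m)),
        F (g ∘ flip ε ∘ g.symm ∘ a) = 0 := fun g ε =>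
      hF.1 _ fun h => ha (Injective.of_comp (Injective.of_comp (Injective.of_comp h)))
    simp [h1, h2]
  · have hP : Fintype.card (Fin m × Bool) = 2 * m := by simp [mul_comm]
    rw [avgOp_apply, ← sum_fiberwise_of_maps_to
      (t := ({a' : I → Fin m × Bool | Injective a'} : Finset _)) (g := fun g => g.symm ∘ a)
      (fun g _ => by simpa using g.symm.injective.comp ha)]
    refine sum_congr rfl fun a' ha' => ?_
    have ha' := (mem_filter.1 ha').2
    have hset : ({g : Fin m × Bool ≃ X | g.symm ∘ a = a'} : Finset _) = extensions a' a := by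
      ext g
      simp only [mem_filter, mem_univ, true_and, mem_extensions]
      constructor
      · rintro rfl k; simp
      · intro h; funext k; simp [← h k]
    rw [hset, sum_comm]
    refine sum_congr rfl fun ε _ => ?_
    have key := sum_extending_eq (P := Fin m × Bool) (hP.trans hc.symm) hF a ha' (flip ε ∘ a')
      ((flip ε).injective.comp ha')
    rw [hP] at key
    rw [← mul_sum, coef, mul_assoc (w ε), ← key]
    congr 1
    refine sum_congr rfl fun g hg => ?_
    have : g.symm ∘ a = a' := by
      funext k; simp [← mem_extensions.1 hg k]
    rw [this]

/-- Permuting the coordinates of a tuple function. -/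
def coordRep (I X : Type*) : Representation ℂ (Perm I) ((I → X) → ℂ) where
  toFun π := LinearMap.funLeft ℂ ℂ (fun a : I → X => a ∘ π)
  map_one' := rfl
  map_mul' _ _ := rfl

/-- The eigenvalue of `avgOp` on symmetric harmonic functions. -/
def symEigenvalue (I : Type*) [Fintype I] [DecidableEq I] (w : Finset (Fin m) → ℂ) : ℂ :=
  ∑ a' : I → Fin m × Bool with Injective a', ∑ ε, coef w a' ε *
    (#(completions a' (flip ε ∘ a')) : ℂ)

theorem avgOp_of_symmetric (hc : Fintype.card X = 2 * m) (w : Finset (Fin m) → ℂ)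
    {F : (I → X) → ℂ} (hF : F ∈ harmonic I X) (hs : ∀ (π : Perm I) a, F (a ∘ π) = F a) :
    avgOp w F = symEigenvalue I w • F := by
  funext a
  rw [avgOp_eq_sum_perm hc w hF]
  simp only [hs, sum_const, nsmul_eq_mul, Pi.smul_apply, symEigenvalue, smul_eq_mul, sum_mul,
    mul_assoc]

/-- On `W` the operator is both the scalar ψ and a combination of the `ρ θ`; compare traces. -/
theorem symEigenvalue_sub_mul (hc : Fintype.card X = 2 * m) (w : Finset (Fin m) → ℂ)
    (W : Submodule ℂ ((I → X) → ℂ)) (hW : W ≤ harmonic I X)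
    (ρ : Representation ℂ (Perm I) W) (hρ : ∀ π (F : W) a, (ρ π F).1 a = F.1 (a ∘ π)) (ψ : ℂ)
    (hψ : ∀ F ∈ W, avgOp w F = ψ • F) :
    (symEigenvalue I w - ψ) * (Module.finrank ℂ W : ℂ) =
      ∑ a' : I → Fin m × Bool with Injective a', ∑ ε, coef w a' ε *
        ∑ θ ∈ completions a' (flip ε ∘ a'), ((Module.finrank ℂ W : ℂ) - ρ.character θ) := by
  have hop : ψ • LinearMap.id = ∑ a' : I → Fin m × Bool with Injective a', ∑ ε, coef w a' ε •
      ∑ θ ∈ completions a' (flip ε ∘ a'), ρ θ := by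
    ext F a
    have := congrFun (hψ F F.2) a
    rw [avgOp_eq_sum_perm hc w (hW F.2)] at this
    simp only [LinearMap.sum_apply, LinearMap.smul_apply, Submodule.coe_sum, Submodule.coe_smul,
      Finset.sum_apply, Pi.smul_apply, hρ, LinearMap.id_apply, smul_eq_mul]
    exact this.symm
  have htr := congrArg (LinearMap.trace ℂ W) hop
  simp only [map_smul, map_sum, LinearMap.trace_id, smul_eq_mul] at htr
  rw [sub_mul, htr, symEigenvalue, sum_mul, ← sum_sub_distrib]
  refine sum_congr rfl fun a' _ => ?_
  rw [sum_mul, ← sum_sub_distrib]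
  refine sum_congr rfl fun ε _ => ?_
  rw [mul_assoc, ← mul_sub, sum_sub_distrib, sum_const, nsmul_eq_mul]
  rfl

end Matching

/-! ### Character sums as dimensions of invariants. -/

section Invariants

variable {G V : Type*} [Group G] [AddCommGroup V] [Module ℂ V] [FiniteDimensional ℂ V]

/-- A sum of group elements that acts as a multiple of a projection onto `U` has trace equal to
that multiple of the dimension of `U`. -/
lemma sum_character_eq {ι : Type*} (ρ : Representation ℂ G V) (L : Finset ι) (hL : L.Nonempty)
    (s : ι → G) (U : Submodule ℂ V) (h1 : ∀ l ∈ L, ∀ v ∈ U, ρ (s l) v = v)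
    (h2 : ∀ v, ∑ l ∈ L, ρ (s l) v ∈ U) :
    ∑ l ∈ L, ρ.character (s l) = (#L : ℂ) * (Module.finrank ℂ U : ℂ) := by
  have hne : (#L : ℂ) ≠ 0 := by exact_mod_cast hL.card_pos.ne'
  have hp : LinearMap.IsProj U ((#L : ℂ)⁻¹ • ∑ l ∈ L, ρ (s l)) := by
    constructor
    · intro v
      rw [LinearMap.smul_apply, LinearMap.sum_apply]
      exact U.smul_mem _ (h2 v)
    · intro v hv
      rw [LinearMap.smul_apply, LinearMap.sum_apply, sum_congr rfl fun l hl => h1 l hl v hv,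
        sum_const, ← Nat.cast_smul_eq_nsmul ℂ, smul_smul, inv_mul_cancel₀ hne, one_smul]
  have := hp.trace
  rw [map_smul, map_sum, smul_eq_mul] at this
  rw [← this, mul_inv_cancel_left₀ hne]
  rfl

end Invariants

/-! ### Sums over subsets, and thinning of a random subset. -/

section PowersetSums

lemma sum_powerset_union {α M : Type*} [DecidableEq α] [AddCommMonoid M] {A B : Finset α}
    (h : Disjoint A B) (f : Finset α → M) :
    ∑ ε ∈ (A ∪ B).powerset, f ε = ∑ α ∈ A.powerset, ∑ β ∈ B.powerset, f (α ∪ β) := by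
  rw [← sum_product']
  refine sum_nbij' (fun ε => (ε ∩ A, ε ∩ B)) (fun x => x.1 ∪ x.2) ?_ ?_ ?_ ?_ ?_
  · intro ε _; simp
  · rintro ⟨x, y⟩ hx
    simp only [mem_product, mem_powerset] at hx ⊢
    exact union_subset_union hx.1 hx.2
  · intro ε hε
    simp only [mem_powerset] at hε
    dsimp only
    rw [← inter_union_distrib_left, inter_eq_left.2 hε]
  · rintro ⟨x, y⟩ hx
    simp only [mem_product, mem_powerset] at hx
    have h1 : x ∩ B = ∅ := disjoint_iff_inter_eq_empty.1 (h.mono_left hx.1)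
    have h2 : y ∩ A = ∅ := disjoint_iff_inter_eq_empty.1 (h.symm.mono_left hx.2)
    simp [union_inter_distrib_right, h1, h2, inter_eq_left.2 hx.1, inter_eq_left.2 hx.2]
  · intro ε hε
    simp only [mem_powerset] at hε
    dsimp only
    rw [← inter_union_distrib_left, inter_eq_left.2 hε]

lemma sum_powerset_image {α β M : Type*} [DecidableEq α] [DecidableEq β] [AddCommMonoid M]
    {J : Finset α} {g : α → β} (hg : Set.InjOn g J) (f : Finset β → M) :
    ∑ ε ∈ (J.image g).powerset, f ε = ∑ B ∈ J.powerset, f (B.image g) := by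
  rw [powerset_image, sum_image]
  intro B hB B' hB' h
  replace h : B.image g = B'.image g := h
  simp only [coe_powerset, Set.mem_preimage, Set.mem_powerset_iff, coe_subset] at hB hB'
  ext k
  constructor
  · intro hk
    have : g k ∈ B'.image g := h ▸ mem_image_of_mem g hk
    obtain ⟨l, hl, hlk⟩ := mem_image.1 this
    exact hg (hB' hl) (hB hk) hlk ▸ hl
  · intro hk
    have : g k ∈ B.image g := h.symm ▸ mem_image_of_mem g hk
    obtain ⟨l, hl, hlk⟩ := mem_image.1 this
    exact hg (hB hl) (hB' hk) hlk ▸ hl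

/-- Keeping each element with probability weight `r` is the same as first selecting elements with
weight `2r` and then keeping each selected one with weight `1/2`. -/
lemma sum_weight_eq {m : ℕ} (q r : ℂ) (f : Finset (Fin m) → ℂ) :
    ∑ ε, (q + r) ^ (m - #ε) * r ^ #ε * f ε =
      ∑ D : Finset (Fin m), q ^ (m - #D) * r ^ #D * ∑ ε ∈ D.powerset, f ε := by
  simp only [mul_sum]
  rw [sum_sigma' univ]
  have : ∀ ε : Finset (Fin m), (q + r) ^ (m - #ε) * r ^ #ε * f ε =
      ∑ C ∈ εᶜ.powerset, q ^ (m - #(ε ∪ C)) * r ^ #(ε ∪ C) * f ε := by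
    intro ε
    rw [← sum_mul]
    congr 1
    have h := sum_pow_mul_eq_add_pow r q εᶜ
    rw [add_comm q r, show m - #ε = #(εᶜ) by simp [card_compl], ← h, sum_mul]
    refine sum_congr rfl fun C hC => ?_
    rw [mem_powerset] at hC
    have hd : Disjoint ε C := disjoint_left.2 fun x hx hx' => by simpa [hx] using hC hx'
    have hle : #ε + #C ≤ m := by
      rw [← card_union_of_disjoint hd]; simpa using card_le_univ (ε ∪ C)
    rw [card_union_of_disjoint hd, card_compl, Fintype.card_fin,
      show m - (#ε + #C) = m - #ε - #C by omega]
    ring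
  rw [sum_congr rfl fun ε _ => this ε, sum_sigma' univ]
  refine sum_nbij' (fun x => ⟨x.1 ∪ x.2, x.1⟩) (fun x => ⟨x.2, x.1 \ x.2⟩) ?_ ?_ ?_ ?_ ?_
  · rintro ⟨ε, C⟩ _
    simp only [mem_sigma, mem_univ, mem_powerset, true_and]
    exact subset_union_left
  · rintro ⟨D, ε⟩ _
    simp only [mem_sigma, mem_univ, mem_powerset, true_and]
    intro x hx; simp at hx ⊢; exact hx.2
  · rintro ⟨ε, C⟩ h
    simp only [mem_sigma, mem_univ, mem_powerset, true_and] at h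
    have hd : Disjoint C ε := disjoint_left.2 fun x hx hx' => by simpa [hx'] using h hx
    simp [union_sdiff_left, sdiff_eq_self_of_disjoint hd]
  · rintro ⟨D, ε⟩ h
    simp only [mem_sigma, mem_univ, mem_powerset, true_and] at h
    simp [union_sdiff_of_subset h]
  · rintro ⟨ε, C⟩ _; rfl

end PowersetSums

/-! ### The contribution of one matching D seen from fixed positions. -/

section FixedMatching

set_option linter.unusedSectionVars false

variable {I : Type*} [Fintype I] [DecidableEq I] {m : ℕ}
  {V : Type*} [AddCommGroup V] [Module ℂ V]

/-- The vectors fixed by all elements of `S`. -/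
def fixedBy {G : Type*} [Group G] (ρ : Representation ℂ G V) (S : Set G) : Submodule ℂ V where
  carrier := {v | ∀ g ∈ S, ρ g v = v}
  add_mem' := fun hv hw g hg => by rw [map_add, hv g hg, hw g hg]
  zero_mem' := fun g _ => map_zero _
  smul_mem' := fun c v hv g hg => by rw [map_smul, hv g hg]

/-- The permutations of `I` that move only elements of `B`. -/
def permsOn (B : Finset I) : Finset (Perm I) := {β | ∀ k ∉ B, β k = k}

lemma mem_permsOn {B : Finset I} {β : Perm I} : β ∈ permsOn B ↔ ∀ k ∉ B, β k = k := by
  simp [permsOn]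

lemma mul_mem_permsOn {B : Finset I} {β γ : Perm I} (hβ : β ∈ permsOn B) (hγ : γ ∈ permsOn B) :
    β * γ ∈ permsOn B := by
  rw [mem_permsOn] at *
  intro k hk
  rw [Perm.mul_apply, hγ k hk, hβ k hk]

lemma inv_mem_permsOn {B : Finset I} {β : Perm I} (hβ : β ∈ permsOn B) : β⁻¹ ∈ permsOn B := by
  rw [mem_permsOn] at *
  intro k hk
  rw [Perm.inv_eq_iff_eq, hβ k hk]

lemma card_permsOn (B : Finset I) : #(permsOn B) = (#B).factorial := by
  have h := Fintype.card_congr (Perm.subtypeEquivSubtypePerm (fun x : I => x ∈ B))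
  rw [Fintype.card_perm, Fintype.card_coe, Fintype.card_subtype] at h
  exact h.symm

/-- The pairs in `D` with exactly one member in the range of `a'`. -/
def splitPairs (a' : I → Fin m × Bool) (D : Finset (Fin m)) : Finset (Fin m) :=
  {j ∈ D | ¬ ((∃ k, a' k = (j, true)) ↔ ∃ k, a' k = (j, false))}

/-- The indices whose position belongs to a pair in `D` with no other member in the range. -/
def loose (a' : I → Fin m × Bool) (D : Finset (Fin m)) : Finset I :=
  {k | (a' k).1 ∈ splitPairs a' D}

/-- The permutations of `I` induced by exchanging the members of pairs in `D` that are not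
split. -/
def innerPerms (a' : I → Fin m × Bool) (D : Finset (Fin m)) : Set (Perm I) :=
  {θ | ∃ ε ⊆ D \ splitPairs a' D, ∀ k, a' (θ k) = flip ε (a' k)}

variable {a' : I → Fin m × Bool} {D : Finset (Fin m)}

lemma mem_splitPairs {j : Fin m} : j ∈ splitPairs a' D ↔
    j ∈ D ∧ ¬ ((∃ k, a' k = (j, true)) ↔ ∃ k, a' k = (j, false)) := by
  simp [splitPairs]

lemma mem_loose {k : I} : k ∈ loose a' D ↔ (a' k).1 ∈ splitPairs a' D := by
  simp [loose]

lemma not_exists_partner {k : I} (hk : k ∈ loose a' D) (l : I) :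
    a' l ≠ ((a' k).1, !(a' k).2) := by
  intro h
  apply (mem_splitPairs.1 (mem_loose.1 hk)).2
  have hk' : a' k = ((a' k).1, (a' k).2) := rfl
  cases hb : (a' k).2
  · rw [hb] at h hk'; exact ⟨fun _ => ⟨k, hk'⟩, fun _ => ⟨l, h⟩⟩
  · rw [hb] at h hk'; exact ⟨fun _ => ⟨l, h⟩, fun _ => ⟨k, hk'⟩⟩

lemma loose_injOn (ha' : Injective a') : Set.InjOn (fun k => (a' k).1) (loose a' D) := by
  intro k hk l _ h
  by_contra hne
  apply not_exists_partner hk l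
  have h2 : (a' k).2 ≠ (a' l).2 := fun h2 => hne (ha' (Prod.ext h h2))
  refine Prod.ext h.symm ?_
  cases h3 : (a' k).2 <;> cases h4 : (a' l).2 <;> simp_all

lemma image_loose : (loose a' D).image (fun k => (a' k).1) = splitPairs a' D := by
  ext j
  simp only [mem_image, mem_loose]
  constructor
  · rintro ⟨k, hk, rfl⟩; exact hk
  · intro hj
    have h := (mem_splitPairs.1 hj).2
    by_cases h1 : ∃ k, a' k = (j, true)
    · obtain ⟨k, hk⟩ := h1
      exact ⟨k, by rwa [hk], by rw [hk]⟩
    · by_cases h2 : ∃ k, a' k = (j, false)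
      · obtain ⟨k, hk⟩ := h2
        exact ⟨k, by rwa [hk], by rw [hk]⟩
      · exact absurd (iff_of_false h1 h2) h

lemma exists_eq_flip {ε : Finset (Fin m)} (hε : ε ⊆ D \ splitPairs a' D) (k : I) :
    ∃ l, a' l = flip ε (a' k) := by
  by_cases h : (a' k).1 ∈ ε
  · have h1 := mem_sdiff.1 (hε h)
    have h2 : (∃ l, a' l = ((a' k).1, true)) ↔ ∃ l, a' l = ((a' k).1, false) := by
      by_contra h2; exact h1.2 (mem_splitPairs.2 ⟨h1.1, h2⟩)
    have hk' : a' k = ((a' k).1, (a' k).2) := rfl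
    rw [flip_apply, if_pos h]
    cases hb : (a' k).2
    · rw [hb] at hk'; exact h2.2 ⟨k, hk'⟩
    · rw [hb] at hk'; exact h2.1 ⟨k, hk'⟩
  · exact ⟨k, by rw [flip_apply, if_neg h]⟩

lemma exists_innerPerm (ha' : Injective a') :
    ∃ t : Finset (Fin m) → Perm I, ∀ ε ⊆ D \ splitPairs a' D, ∀ k, a' (t ε k) = flip ε (a' k) := by
  have : ∀ ε : Finset (Fin m), ∃ θ : Perm I, ε ⊆ D \ splitPairs a' D →
      ∀ k, a' (θ k) = flip ε (a' k) := by
    intro ε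
    by_cases hε : ε ⊆ D \ splitPairs a' D
    · choose θ hθ using exists_eq_flip hε
      have hinj : Injective θ := fun k l h => ha' ((flip ε).injective (by rw [← hθ, ← hθ, h]))
      exact ⟨Equiv.ofBijective θ (Finite.injective_iff_bijective.1 hinj), fun _ => hθ⟩
    · exact ⟨1, fun h => absurd h hε⟩
  choose t ht using this
  exact ⟨t, ht⟩

lemma innerPerm_apply_of_loose (ha' : Injective a') {θ : Perm I} (hθ : θ ∈ innerPerms a' D) {k : I}
    (hk : k ∈ loose a' D) : θ k = k := by
  obtain ⟨ε, hε, h⟩ := hθ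
  apply ha'
  rw [h, flip_apply, if_neg fun hm => (mem_sdiff.1 (hε hm)).2 (mem_loose.1 hk)]

lemma flip_union_apply (ha' : Injective a') {B : Finset I} (hB : B ⊆ loose a' D)
    (ε : Finset (Fin m)) {k : I} (hk : k ∉ B) :
    flip (ε ∪ B.image fun k => (a' k).1) (a' k) = flip ε (a' k) := by
  have : (a' k).1 ∉ B.image fun k => (a' k).1 := by
    intro h
    obtain ⟨l, hl, hlk⟩ := mem_image.1 h
    have hkl : k ∈ loose a' D := by
      rw [mem_loose, ← hlk]; exact mem_loose.1 (hB hl)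
    exact hk (loose_injOn ha' (hB hl) hkl hlk ▸ hl)
  simp only [flip_apply, mem_union, this, or_false]

lemma outside_flip_union (ha' : Injective a') {B : Finset I} (hB : B ⊆ loose a' D)
    {ε : Finset (Fin m)} (hε : ε ⊆ D \ splitPairs a' D) :
    outside a' (flip (ε ∪ B.image fun k => (a' k).1) ∘ a') = B := by
  ext k
  rw [mem_outside]
  constructor
  · intro h
    by_contra hk
    obtain ⟨l, hl⟩ := exists_eq_flip hε k
    exact h l (by rw [hl, Function.comp_apply, flip_union_apply ha' hB ε hk])
  · intro hk l
    have hm : (a' k).1 ∈ ε ∪ B.image fun k => (a' k).1 :=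
      mem_union_right _ (mem_image_of_mem (fun k => (a' k).1) hk)
    rw [Function.comp_apply, flip_apply, if_pos hm]
    exact not_exists_partner (hB hk) l

/-- The flips in `ε` permute the occupied positions, while those coming from `B` send the indices of
`B` to unoccupied ones. A completion is therefore prescribed off `B` and free on `B`: a coset of the
permutations of `B`. -/
lemma sum_completions_flip (ha' : Injective a') {B : Finset I} (hB : B ⊆ loose a' D)
    {ε : Finset (Fin m)} (hε : ε ⊆ D \ splitPairs a' D) {t : Perm I}
    (ht : ∀ k, a' (t k) = flip ε (a' k)) (f : Perm I → ℂ) :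
    ∑ θ ∈ completions a' (flip (ε ∪ B.image fun k => (a' k).1) ∘ a'), f θ =
      ∑ β ∈ permsOn B, f (t * β) := by
  refine sum_nbij' (fun θ => t⁻¹ * θ) (fun β => t * β) ?_ ?_ ?_ ?_ ?_
  · intro θ hθ
    rw [mem_permsOn]
    simp only [completions, outside_flip_union ha' hB hε, mem_filter, mem_univ, true_and] at hθ
    intro k hk
    rw [Perm.mul_apply, Perm.inv_eq_iff_eq]
    apply ha'
    rw [hθ k hk, ht, Function.comp_apply, flip_union_apply ha' hB ε hk]
  · intro β hβ
    rw [mem_permsOn] at hβ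
    simp only [completions, outside_flip_union ha' hB hε, mem_filter, mem_univ, true_and]
    intro k hk
    rw [Perm.mul_apply, hβ k hk, ht, Function.comp_apply, flip_union_apply ha' hB ε hk]
  · intro θ _; simp
  · intro β _; simp
  · intro θ _; simp

/-- Inner exchanges compose by symmetric difference and commute with the permutations of `B`, so the
double sum is a multiple of a projection onto the common invariants. Indexing by `ε` matters:
flipping an unoccupied pair induces the identity, so different `ε` may give the same permutation. -/
lemma sum_character_matching [FiniteDimensional ℂ V] (ρ : Representation ℂ (Perm I) V)
    (ha' : Injective a') {B : Finset I} (hB : B ⊆ loose a' D) :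
    ∑ ε ∈ (D \ splitPairs a' D).powerset,
      ∑ θ ∈ completions a' (flip (ε ∪ B.image fun k => (a' k).1) ∘ a'),
        ((Module.finrank ℂ V : ℂ) - ρ.character θ) =
      2 ^ #(D \ splitPairs a' D) * ((#B).factorial : ℂ) * ((Module.finrank ℂ V : ℂ) -
        (Module.finrank ℂ
          ↥(fixedBy ρ (innerPerms a' D) ⊓ fixedBy ρ (permsOn B : Set (Perm I))) : ℂ)) := by
  obtain ⟨t, ht⟩ := exists_innerPerm (D := D) ha'
  rw [sum_congr rfl fun ε hε => sum_completions_flip ha' hB (mem_powerset.1 hε)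
    (ht ε (mem_powerset.1 hε)) _]
  rw [← sum_product', sum_sub_distrib, sum_const, nsmul_eq_mul]
  have hin : ∀ ε ⊆ D \ splitPairs a' D, t ε ∈ innerPerms a' D := fun ε hε => ⟨ε, hε, ht ε hε⟩
  have hcomm : ∀ ε ⊆ D \ splitPairs a' D, ∀ β ∈ permsOn B, β * t ε = t ε * β := by
    intro ε hε β hβ
    have : Perm.Disjoint β (t ε) := by
      intro k
      by_cases hk : k ∈ B
      · exact Or.inr (innerPerm_apply_of_loose ha' (hin ε hε) (hB hk))
      · exact Or.inl (mem_permsOn.1 hβ k hk)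
    exact this.commute
  have key := sum_character_eq ρ ((D \ splitPairs a' D).powerset ×ˢ permsOn B)
    ⟨(∅, 1), by simp [mem_permsOn]⟩ (fun l => t l.1 * l.2)
    (fixedBy ρ (innerPerms a' D) ⊓ fixedBy ρ (permsOn B : Set (Perm I))) ?_ ?_
  · rw [key, card_product, card_powerset, card_permsOn]
    push_cast
    ring
  · rintro ⟨ε, β⟩ hl v hv
    simp only [mem_product, mem_powerset] at hl
    rw [map_mul, Module.End.mul_apply, hv.2 β (mem_coe.2 hl.2), hv.1 _ (hin ε hl.1)]
  · intro v
    constructor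
    · rintro θ ⟨δ, hδ, hθ⟩
      rw [map_sum]
      have hmem : ∀ ε ⊆ D \ splitPairs a' D, symmDiff δ ε ⊆ D \ splitPairs a' D := by
        intro ε hε x hx
        rcases mem_symmDiff.1 hx with h | h
        · exact hδ h.1
        · exact hε h.1
      refine sum_nbij' (fun l => (symmDiff δ l.1, l.2)) (fun l => (symmDiff δ l.1, l.2))
        ?_ ?_ ?_ ?_ ?_
      · rintro ⟨ε, β⟩ hl
        simp only [mem_product, mem_powerset] at hl ⊢
        exact ⟨hmem ε hl.1, hl.2⟩
      · rintro ⟨ε, β⟩ hl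
        simp only [mem_product, mem_powerset] at hl ⊢
        exact ⟨hmem ε hl.1, hl.2⟩
      · rintro ⟨ε, β⟩ _; simp
      · rintro ⟨ε, β⟩ _; simp
      · rintro ⟨ε, β⟩ hl
        simp only [mem_product, mem_powerset] at hl
        have : θ * t ε = t (symmDiff δ ε) := by
          ext k
          apply ha'
          rw [Perm.mul_apply, hθ, ht ε hl.1, flip_flip, ht _ (hmem ε hl.1)]
        rw [← Module.End.mul_apply, ← map_mul, ← mul_assoc, this]
    · intro γ hγ
      rw [mem_coe] at hγ
      rw [map_sum]
      refine sum_nbij' (fun l => (l.1, γ * l.2)) (fun l => (l.1, γ⁻¹ * l.2)) ?_ ?_ ?_ ?_ ?_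
      · rintro ⟨ε, β⟩ hl
        simp only [mem_product, mem_powerset] at hl ⊢
        exact ⟨hl.1, mul_mem_permsOn hγ hl.2⟩
      · rintro ⟨ε, β⟩ hl
        simp only [mem_product, mem_powerset] at hl ⊢
        exact ⟨hl.1, mul_mem_permsOn (inv_mem_permsOn hγ) hl.2⟩
      · rintro ⟨ε, β⟩ _; simp
      · rintro ⟨ε, β⟩ _; simp
      · rintro ⟨ε, β⟩ hl
        simp only [mem_product, mem_powerset] at hl
        rw [← Module.End.mul_apply, ← map_mul, ← mul_assoc, hcomm ε hl.1 γ hγ, mul_assoc]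

/-- The contribution of a partial matching `D`, seen from the positions `a'`, to the spectral
gap. -/
def gapTerm (ρ : Representation ℂ (Perm I) V) (a' : I → Fin m × Bool) (D : Finset (Fin m)) : ℝ :=
  2 ^ #(D \ splitPairs a' D) * ∑ B ∈ (loose a' D).powerset,
    (-1) ^ #B * ((2 * m - Fintype.card I - #B).factorial : ℝ) * ((#B).factorial : ℝ) *
      ((Module.finrank ℂ V : ℝ) - (Module.finrank ℂ
          ↥(fixedBy ρ (innerPerms a' D) ⊓ fixedBy ρ (permsOn B : Set (Perm I))) : ℝ))

/-- Split pairs correspond to loose indices. A subset of `D` is hence a set of unsplit pairs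
together with a set `B` of loose indices, and `B` is exactly the set of indices sent outside. -/
theorem sum_powerset_matching [FiniteDimensional ℂ V] (ρ : Representation ℂ (Perm I) V)
    (ha' : Injective a') (D : Finset (Fin m)) :
    ∑ ε ∈ D.powerset, ((-1 : ℂ) ^ #(outside a' (flip ε ∘ a')) *
      ((2 * m - Fintype.card I - #(outside a' (flip ε ∘ a'))).factorial : ℂ)) *
        ∑ θ ∈ completions a' (flip ε ∘ a'), ((Module.finrank ℂ V : ℂ) - ρ.character θ) =
      (gapTerm ρ a' D : ℂ) := by
  have hD : D = (D \ splitPairs a' D) ∪ (loose a' D).image (fun k => (a' k).1) := by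
    rw [image_loose, sdiff_union_of_subset (show splitPairs a' D ⊆ D from filter_subset _ _)]
  have hdisj : Disjoint (D \ splitPairs a' D) ((loose a' D).image (fun k => (a' k).1)) := by
    rw [image_loose]; exact sdiff_disjoint
  conv_lhs => rw [hD]
  rw [sum_powerset_union hdisj]
  rw [sum_congr rfl fun ε _ => sum_powerset_image (loose_injOn ha') _, sum_comm, gapTerm]
  push_cast
  rw [mul_sum]
  refine sum_congr rfl fun B hB => ?_
  have hB := mem_powerset.1 hB
  rw [sum_congr rfl fun ε hε => by rw [outside_flip_union ha' hB (mem_powerset.1 hε)], ← mul_sum,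
    sum_character_matching ρ ha' hB]
  ring

end FixedMatching

/-! ### Inequalities for alternating sums. -/

section AlternatingSums

lemma alternating_sum_mem_Icc (n : ℕ) : ∀ {f : ℕ → ℝ}, Antitone f → (∀ k, 0 ≤ f k) →
    0 ≤ ∑ k ∈ range n, (-1) ^ k * f k ∧ ∑ k ∈ range n, (-1) ^ k * f k ≤ f 0 := by
  induction n with
  | zero => intro f _ h0; simpa using h0 0
  | succ n ih =>
    intro f hf h0
    have h := ih (f := fun k => f (k + 1)) (fun a b hab => hf (by omega)) (fun k => h0 _)
    have hs : ∑ k ∈ range (n + 1), (-1) ^ k * f k =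
        f 0 - ∑ k ∈ range n, (-1) ^ k * f (k + 1) := by
      rw [sum_range_succ', sub_eq_neg_add, ← sum_neg_distrib]
      congr 1
      · exact sum_congr rfl fun k _ => by ring
      · simp
    have h1 := hf (Nat.zero_le 1)
    rw [hs]
    constructor <;> linarith [h.1, h.2]

lemma sub_le_alternating_sum (n : ℕ) {f : ℕ → ℝ} (hf : Antitone f) (h0 : ∀ k, 0 ≤ f k) :
    f 0 - f 1 ≤ ∑ k ∈ range (n + 1), (-1) ^ k * f k := by
  have h := alternating_sum_mem_Icc n (f := fun k => f (k + 1)) (fun a b hab => hf (by omega))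
    (fun k => h0 _)
  have hs : ∑ k ∈ range (n + 1), (-1) ^ k * f k =
      f 0 - ∑ k ∈ range n, (-1) ^ k * f (k + 1) := by
    rw [sum_range_succ', sub_eq_neg_add, ← sum_neg_distrib]
    congr 1
    · exact sum_congr rfl fun k _ => by ring
    · simp
  rw [hs]
  linarith [h.2]

/-- An alternating sum of products of a convex decreasing sequence with a concave increasing one
is nonnegative. -/
lemma alternating_sum_convex_concave_nonneg (s : ℕ) {a V : ℕ → ℝ} (ha : Antitone a)
    (hconv : ∀ b, 2 * a (b + 1) ≤ a b + a (b + 2)) (hzero : ∀ b, s < b → a b = 0)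
    (hV0 : V 0 = 0) (hV1 : V 1 = 0) (hV : Monotone V)
    (hconc : ∀ b, 1 ≤ b → V b + V (b + 2) ≤ 2 * V (b + 1)) :
    0 ≤ ∑ b ∈ range (s + 1), (-1) ^ b * (a b * V b) := by
  have ha0 : ∀ b, 0 ≤ a b := fun b => by
    rw [← hzero (max b (s + 1)) (by omega)]; exact ha (le_max_left _ _)
  -- The alternating tails of `a` satisfy `a j = r j + r (j + 1)`; monotonicity of `a` makes them
  -- nonnegative and convexity makes them decreasing.
  set r : ℕ → ℝ := fun j => ∑ l ∈ range (s + 1), (-1) ^ l * a (j + l) with hr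
  have hr0 : ∀ j, 0 ≤ r j := fun j =>
    (alternating_sum_mem_Icc (s + 1) (f := fun l => a (j + l)) (fun x y h => ha (by omega))
      (fun _ => ha0 _)).1
  have hradd : ∀ j, a j = r j + r (j + 1) := by
    intro j
    simp only [hr]
    rw [sum_range_succ', sum_range_succ (n := s), hzero (j + 1 + s) (by omega)]
    simp only [pow_zero, add_zero, one_mul, mul_zero]
    rw [add_right_comm, ← sum_add_distrib, sum_eq_zero, zero_add]
    intro l _
    rw [show j + 1 + l = j + (l + 1) by ring]; ring
  have hranti : Antitone r := antitone_nat_of_succ_le fun j => by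
    have h := (alternating_sum_mem_Icc (s + 1) (f := fun l => a (j + l) - a (j + l + 1))
      (antitone_nat_of_succ_le fun l => by
        have e1 : a (j + (l + 1)) = a (j + l + 1) := rfl
        have e2 : a (j + (l + 1) + 1) = a (j + l + 2) := rfl
        linarith [hconv (j + l)])
      (fun l => by linarith [ha (Nat.le_succ (j + l))])).1
    simp only [mul_sub, sum_sub_distrib] at h
    have e : r (j + 1) = ∑ l ∈ range (s + 1), (-1) ^ l * a (j + l + 1) :=
      sum_congr rfl fun l _ => by rw [show j + 1 + l = j + l + 1 by ring]
    linarith [h, e, show r j = ∑ l ∈ range (s + 1), (-1) ^ l * a (j + l) from rfl]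
  -- Summation by parts leaves an alternating sum of `r (c + 2) * (V (c + 2) - V (c + 1))`, a
  -- product of two nonnegative decreasing sequences. The boundary term vanishes at `M = s`.
  have habel : ∀ M, ∑ b ∈ range (M + 2), (-1) ^ b * (a b * V b) =
      ∑ c ∈ range M, (-1) ^ c * (r (c + 2) * (V (c + 2) - V (c + 1))) +
        (-1) ^ (M + 1) * (r (M + 2) * V (M + 1)) := by
    intro M
    induction M with
    | zero => simp [sum_range_succ, hV0, hV1]
    | succ M ih =>
      rw [sum_range_succ, ih, sum_range_succ (n := M), hradd (M + 2)]
      ring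
  have hext : ∑ b ∈ range (s + 1), (-1) ^ b * (a b * V b) =
      ∑ b ∈ range (s + 2), (-1) ^ b * (a b * V b) := by
    rw [sum_range_succ (n := s + 1), hzero (s + 1) (by omega)]; simp
  have hrs : r (s + 2) = 0 := sum_eq_zero fun l _ => by rw [hzero _ (by omega), mul_zero]
  rw [hext, habel, hrs, zero_mul, mul_zero, add_zero]
  refine (alternating_sum_mem_Icc s (f := fun c => r (c + 2) * (V (c + 2) - V (c + 1)))
    (antitone_nat_of_succ_le fun c => ?_) fun c => ?_).1
  · have h1 := hconc (c + 1) (by omega)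
    have h2 := hV (show c + 1 + 1 ≤ c + 1 + 2 by omega)
    exact mul_le_mul (hranti (show c + 2 ≤ c + 1 + 2 by omega)) (by
      have e1 : V (c + 1 + 2) = V (c + 3) := rfl
      have e2 : V (c + 1 + 1) = V (c + 2) := rfl
      linarith) (by linarith) (hr0 _)
  · exact mul_nonneg (hr0 _) (by linarith [hV (show c + 1 ≤ c + 2 by omega)])

/-- Serves the case of constant binomial weights. The partial sums lie in `[0, V n]` for even `n`
and in `[-V n, 0]` for odd `n`. -/
lemma neg_le_alternating_sum {V : ℕ → ℝ} (hV0 : V 0 = 0) (hV : Monotone V) (n : ℕ) :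
    -V n ≤ ∑ b ∈ range (n + 1), (-1) ^ b * V b := by
  have h : ∀ n, (Even n → 0 ≤ ∑ b ∈ range (n + 1), (-1) ^ b * V b ∧
      ∑ b ∈ range (n + 1), (-1) ^ b * V b ≤ V n) ∧ (¬ Even n →
      ∑ b ∈ range (n + 1), (-1) ^ b * V b ≤ 0 ∧ -V n ≤ ∑ b ∈ range (n + 1), (-1) ^ b * V b) := by
    intro n
    induction n with
    | zero => simp [hV0]
    | succ n ih =>
      have hm := hV (Nat.le_succ n)
      rw [sum_range_succ]
      constructor
      · intro he
        rw [he.neg_one_pow]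
        have := ih.2 (by rwa [Nat.even_add_one] at he)
        constructor <;> linarith [this.1, this.2, show V n.succ = V (n + 1) from rfl]
      · intro he
        rw [(Nat.not_even_iff_odd.1 he).neg_one_pow]
        have := ih.1 (by rwa [Nat.even_add_one, not_not] at he)
        constructor <;> linarith [this.1, this.2, show V n.succ = V (n + 1) from rfl]
  have hn : 0 ≤ V n := hV0 ▸ hV (Nat.zero_le n)
  by_cases he : Even n
  · linarith [((h n).1 he).1]
  · exact ((h n).2 he).2

end AlternatingSums

/-! ### Dimensions of invariants of symmetric groups on subsets: monotonicity and convexity. -/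

section Dimensions

set_option linter.unusedSectionVars false

variable {I : Type*} [Fintype I] [DecidableEq I]
  {V : Type*} [AddCommGroup V] [Module ℂ V]

lemma permsOn_mono {B C : Finset I} (h : B ⊆ C) : permsOn B ⊆ permsOn C := fun β hβ => by
  rw [mem_permsOn] at *
  exact fun k hk => hβ k fun hB => hk (h hB)

lemma swap_mem_permsOn {B : Finset I} {x y : I} (hx : x ∈ B) (hy : y ∈ B) :
    swap x y ∈ permsOn B := by
  rw [mem_permsOn]
  intro k hk
  exact swap_apply_of_ne_of_ne (fun h => hk (h ▸ hx)) (fun h => hk (h ▸ hy))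

lemma fixedBy_anti {ρ : Representation ℂ (Perm I) V} {S T : Set (Perm I)} (h : S ⊆ T) :
    fixedBy ρ T ≤ fixedBy ρ S := fun _ hv g hg => hv g (h hg)

lemma rep_swap_self (ρ : Representation ℂ (Perm I) V) (x : I) (v : V) :
    ρ (swap x x) v = v := by
  rw [swap_self, ← Perm.one_def, map_one, Module.End.one_apply]

lemma mem_fixedBy_of_swaps {ρ : Representation ℂ (Perm I) V} {B : Finset I} {v : V}
    (h : ∀ x ∈ B, ∀ y ∈ B, ρ (swap x y) v = v) : v ∈ fixedBy ρ (permsOn B : Set (Perm I)) := by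
  intro β hβ
  rw [mem_coe, mem_permsOn] at hβ
  have hmem : ∀ k, k ∈ B ↔ β k ∈ B := by
    intro k
    by_cases hk : k ∈ B
    · refine iff_of_true hk ?_
      by_contra hn
      have := β.injective (hβ _ hn)
      rw [this] at hn
      exact hn hk
    · rw [hβ k hk]
  have heq : Perm.ofSubtype (β.subtypePerm (p := (· ∈ B)) fun k => (hmem k).symm) = β :=
    Perm.ofSubtype_subtypePerm _ fun k hk => by
      by_contra hn
      exact hk (hβ k hn)
  rw [← heq]
  generalize β.subtypePerm (p := (· ∈ B)) _ = γ
  induction γ using Perm.swap_induction_on with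
  | one => simp
  | swap_mul γ x y _ ih =>
    rw [map_mul, map_mul, Module.End.mul_apply, ih, Perm.ofSubtype_swap_eq]
    exact h _ x.2 _ y.2

/-- An element l of `B` yields the missing transposition as (j k) = (l j)(l k)(l j). The need for
such an l is why convexity of the dimensions only starts at size 1. -/
lemma fixedBy_inf_fixedBy_le {ρ : Representation ℂ (Perm I) V} {B : Finset I} (hB : B.Nonempty)
    (j k : I) : fixedBy ρ (permsOn (insert j B) : Set (Perm I)) ⊓
      fixedBy ρ (permsOn (insert k B) : Set (Perm I)) ≤
    fixedBy ρ (permsOn (insert j (insert k B)) : Set (Perm I)) := by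
  rintro v ⟨hj, hk⟩
  obtain ⟨l, hl⟩ := hB
  have hj' : ∀ x ∈ insert j B, ∀ y ∈ insert j B, ρ (swap x y) v = v := fun x hx y hy =>
    hj _ (mem_coe.2 (swap_mem_permsOn hx hy))
  have hk' : ∀ x ∈ insert k B, ∀ y ∈ insert k B, ρ (swap x y) v = v := fun x hx y hy =>
    hk _ (mem_coe.2 (swap_mem_permsOn hx hy))
  have hjk : ρ (swap j k) v = v := by
    by_cases hlj : l = j
    · subst hlj
      exact hk' _ (mem_insert_of_mem hl) _ (mem_insert_self _ _)
    by_cases hlk : l = k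
    · subst hlk
      exact hj' _ (mem_insert_self _ _) _ (mem_insert_of_mem hl)
    by_cases hjk : j = k
    · subst hjk; exact rep_swap_self ρ _ _
    have : swap j k = swap l j * swap l k * swap l j := by
      rw [swap_comm l k, swap_mul_swap_mul_swap (Ne.symm hlk) (Ne.symm hjk)]
    rw [this, map_mul, map_mul, Module.End.mul_apply, Module.End.mul_apply,
      hj' _ (mem_insert_of_mem hl) _ (mem_insert_self _ _),
      hk' _ (mem_insert_of_mem hl) _ (mem_insert_self _ _),
      hj' _ (mem_insert_of_mem hl) _ (mem_insert_self _ _)]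
  apply mem_fixedBy_of_swaps
  intro x hx y hy
  simp only [mem_insert] at hx hy
  rcases hx with rfl | rfl | hx <;> rcases hy with rfl | rfl | hy
  · exact rep_swap_self ρ _ _
  · exact hjk
  · exact hj' _ (mem_insert_self _ _) _ (mem_insert_of_mem hy)
  · rw [swap_comm]; exact hjk
  · exact rep_swap_self ρ _ _
  · exact hk' _ (mem_insert_self _ _) _ (mem_insert_of_mem hy)
  · exact hj' _ (mem_insert_of_mem hx) _ (mem_insert_self _ _)
  · exact hk' _ (mem_insert_of_mem hx) _ (mem_insert_self _ _)
  · exact hj' _ (mem_insert_of_mem hx) _ (mem_insert_of_mem hy)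

lemma exists_perm_image {J B C : Finset I} (hB : B ⊆ J) (hC : C ⊆ J) (h : #B = #C) :
    ∃ π ∈ permsOn J, ∀ k, π k ∈ C ↔ k ∈ B := by
  have hcard : Fintype.card {x : J // x.1 ∈ B} = Fintype.card {x : J // x.1 ∈ C} := by
    have e : ∀ D : Finset I, D ⊆ J → Fintype.card {x : J // x.1 ∈ D} = #D := by
      intro D hD
      rw [← Fintype.card_coe]
      exact Fintype.card_congr
        ⟨fun x => ⟨x.1.1, x.2⟩, fun x => ⟨⟨x.1, hD x.2⟩, x.2⟩, fun _ => rfl, fun _ => rfl⟩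
    rw [e B hB, e C hC, h]
  let e := Fintype.equivOfCardEq hcard
  let π := e.extendSubtype
  refine ⟨Perm.ofSubtype π, ?_, fun k => ?_⟩
  · rw [mem_permsOn]
    exact fun k hk => Perm.ofSubtype_apply_of_not_mem _ hk
  · by_cases hk : k ∈ J
    · rw [Perm.ofSubtype_apply_of_mem _ hk]
      by_cases hkB : k ∈ B
      · exact iff_of_true (e.extendSubtype_mem ⟨k, hk⟩ hkB) hkB
      · exact iff_of_false (e.extendSubtype_not_mem ⟨k, hk⟩ hkB) hkB
    · rw [Perm.ofSubtype_apply_of_not_mem _ hk]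
      exact iff_of_false (fun h => hk (hC h)) (fun h => hk (hB h))

variable [FiniteDimensional ℂ V]

/-- The dimension of the vectors of `U` invariant under the permutations of `B`. -/
def invDim (ρ : Representation ℂ (Perm I) V) (U : Submodule ℂ V) (B : Finset I) : ℕ :=
  Module.finrank ℂ ↥(U ⊓ fixedBy ρ (permsOn B : Set (Perm I)))

variable {ρ : Representation ℂ (Perm I) V} {U : Submodule ℂ V} {J : Finset I}

lemma invDim_anti {B C : Finset I} (h : B ⊆ C) : invDim ρ U C ≤ invDim ρ U B :=
  Submodule.finrank_mono (inf_le_inf_left _ (fixedBy_anti (coe_subset.2 (permsOn_mono h))))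

/-- A permutation of `J` carrying `B` to `C` preserves `U` and conjugates one symmetric group into
the other. -/
lemma invDim_eq_of_card_eq (hU : ∀ β ∈ permsOn J, ∀ v ∈ U, ρ β v ∈ U) {B C : Finset I}
    (hB : B ⊆ J) (hC : C ⊆ J) (h : #B = #C) : invDim ρ U B = invDim ρ U C := by
  have key : ∀ {B C : Finset I}, B ⊆ J → C ⊆ J → #B = #C → invDim ρ U B ≤ invDim ρ U C := by
    intro B C hB hC h
    obtain ⟨π, hπ, hBC⟩ := exists_perm_image hB hC h
    have hinj : Injective (ρ π) := fun v w hvw => by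
      have := congrArg (ρ π⁻¹) hvw
      rwa [← Module.End.mul_apply, ← Module.End.mul_apply, ← map_mul, inv_mul_cancel, map_one,
        Module.End.one_apply, Module.End.one_apply] at this
    rw [invDim, (Submodule.equivMapOfInjective (ρ π) hinj _).finrank_eq]
    refine Submodule.finrank_mono ?_
    rintro _ ⟨v, ⟨hvU, hv⟩, rfl⟩
    refine ⟨hU π hπ v hvU, fun β hβ => ?_⟩
    have hconj : π⁻¹ * β * π ∈ permsOn B := by
      rw [mem_permsOn]
      intro k hk
      rw [Perm.mul_apply, Perm.mul_apply, mem_permsOn.1 (mem_coe.1 hβ) _ (by rwa [hBC]),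
        Perm.inv_eq_iff_eq]
    rw [← Module.End.mul_apply, ← map_mul, show β * π = π * (π⁻¹ * β * π) by group, map_mul,
      Module.End.mul_apply, hv _ (mem_coe.2 hconj)]
  exact le_antisymm (key hB hC h) (key hC hB h.symm)

lemma invDim_of_card_le_one {B : Finset I} (h : #B ≤ 1) :
    invDim ρ U B = Module.finrank ℂ U := by
  have : fixedBy ρ (permsOn B : Set (Perm I)) = ⊤ := by
    rw [eq_top_iff]
    intro v _
    apply mem_fixedBy_of_swaps
    intro x hx y hy
    rw [card_le_one.1 h x hx y hy]; exact rep_swap_self ρ _ _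
  rw [invDim, this, inf_top_eq]

/-- The dimension formula for a sum and an intersection: the sum of the two spaces lies in the
invariants of `B`, their intersection in those of `B` with both points added. -/
lemma invDim_insert_add_le {B : Finset I} (hB : B.Nonempty) (j k : I) :
    invDim ρ U (insert j B) + invDim ρ U (insert k B) ≤
      invDim ρ U B + invDim ρ U (insert j (insert k B)) := by
  have h := Submodule.finrank_sup_add_finrank_inf_eq
    (U ⊓ fixedBy ρ (permsOn (insert j B) : Set (Perm I)))
    (U ⊓ fixedBy ρ (permsOn (insert k B) : Set (Perm I)))
  rw [invDim, invDim, ← h]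
  refine add_le_add (Submodule.finrank_mono (sup_le ?_ ?_)) (Submodule.finrank_mono ?_)
  · exact inf_le_inf_left _ (fixedBy_anti (coe_subset.2 (permsOn_mono (subset_insert _ _))))
  · exact inf_le_inf_left _ (fixedBy_anti (coe_subset.2 (permsOn_mono (subset_insert _ _))))
  · rintro v ⟨⟨h1, h2⟩, ⟨_, h3⟩⟩
    exact ⟨h1, fixedBy_inf_fixedBy_le hB j k ⟨h2, h3⟩⟩

/-- The dimensions `invDim ρ U B` depend only on `#B`, and form a decreasing sequence that is
convex from `1` on. -/
lemma exists_dim_sequence (hU : ∀ β ∈ permsOn J, ∀ v ∈ U, ρ β v ∈ U) :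
    ∃ d : ℕ → ℝ, (∀ B ⊆ J, (invDim ρ U B : ℝ) = d #B) ∧ d 0 = Module.finrank ℂ U ∧
      d 1 = Module.finrank ℂ U ∧ Antitone d ∧ ∀ b, 1 ≤ b → 2 * d (b + 1) ≤ d b + d (b + 2) := by
  -- Truncating at `#J` makes the sequence constant from there on, so at that end convexity needs
  -- only monotonicity.
  have hC : ∀ b : ℕ, ∃ C ⊆ J, #C = min b #J := fun b => exists_subset_card_eq (min_le_right _ _)
  choose C hCJ hCc using hC
  have hval : ∀ B ⊆ J, ∀ b, min b #J = #B → invDim ρ U (C b) = invDim ρ U B := fun B hB b hb =>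
    invDim_eq_of_card_eq hU (hCJ b) hB (by rw [hCc, hb])
  have hanti : Antitone fun b => (invDim ρ U (C b) : ℝ) := by
    intro b b' hbb
    obtain ⟨B, hB, hBc⟩ := exists_subset_card_eq
      (show min b #J ≤ #(C b') by rw [hCc]; exact min_le_min_right _ hbb)
    dsimp only
    rw [hval B (hB.trans (hCJ _)) b hBc.symm]
    exact_mod_cast invDim_anti hB
  refine ⟨fun b => invDim ρ U (C b), fun B hB => ?_, ?_, ?_, hanti, fun b hb => ?_⟩
  · dsimp only
    rw [hval B hB _ (min_eq_left (card_le_card hB))]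
  · dsimp only
    rw [invDim_of_card_le_one (by rw [hCc]; omega)]
  · dsimp only
    rw [invDim_of_card_le_one (by rw [hCc]; omega)]
  · dsimp only
    by_cases hs : b + 2 ≤ #J
    · have hc2 : #(C (b + 2)) = b + 2 := by rw [hCc]; omega
      obtain ⟨j, hj⟩ : (C (b + 2)).Nonempty := card_pos.1 (by omega)
      have hc1 : #((C (b + 2)).erase j) = b + 1 := by rw [card_erase_of_mem hj]; omega
      obtain ⟨k, hk⟩ : ((C (b + 2)).erase j).Nonempty := card_pos.1 (by omega)
      set B := ((C (b + 2)).erase j).erase k with hBdef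
      have hc0 : #B = b := by rw [card_erase_of_mem hk]; omega
      have hkB : insert k B = (C (b + 2)).erase j := insert_erase hk
      have hjkB : insert j (insert k B) = C (b + 2) := by rw [hkB, insert_erase hj]
      have hBJ : B ⊆ J := ((erase_subset _ _).trans (erase_subset _ _)).trans (hCJ _)
      have hjB : j ∉ B := fun h => by simp [hBdef] at h
      have h1J : insert k B ⊆ J := by rw [hkB]; exact (erase_subset _ _).trans (hCJ _)
      have h2J : insert j B ⊆ J := insert_subset (hCJ _ hj) hBJ
      have h := invDim_insert_add_le (ρ := ρ) (U := U) (card_pos.1 (by omega : 0 < #B)) j k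
      rw [hjkB, ← hval _ h1J (b + 1) (by rw [hkB, hc1]; omega),
        ← hval _ h2J (b + 1) (by rw [card_insert_of_notMem hjB, hc0]; omega),
        ← hval B hBJ b (by omega)] at h
      rw [two_mul]
      exact_mod_cast h
    · by_cases hs' : b + 1 ≤ #J
      · have e : invDim ρ U (C (b + 2)) = invDim ρ U (C (b + 1)) :=
          hval _ (hCJ _) _ (by rw [hCc]; omega)
        have := hanti (Nat.le_succ b)
        dsimp only at this
        rw [e]
        linarith [this, show (invDim ρ U (C b.succ) : ℝ) = invDim ρ U (C (b + 1)) from rfl]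
      · have e : invDim ρ U (C (b + 2)) = invDim ρ U (C b) :=
          hval _ (hCJ _) _ (by rw [hCc]; omega)
        have e' : invDim ρ U (C (b + 1)) = invDim ρ U (C b) :=
          hval _ (hCJ _) _ (by rw [hCc]; omega)
        rw [e, e']; linarith

end Dimensions

/-! ### Nonnegativity of a contribution when s < N. -/

section GapTerm

set_option linter.unusedSectionVars false

variable {I : Type*} [Fintype I] [DecidableEq I] {m : ℕ}
  {V : Type*} [AddCommGroup V] [Module ℂ V] [FiniteDimensional ℂ V]
  {ρ : Representation ℂ (Perm I) V} {a' : I → Fin m × Bool} {D : Finset (Fin m)}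

lemma card_loose (ha' : Injective a') : #(loose a' D) = #(splitPairs a' D) := by
  rw [← image_loose, card_image_of_injOn (loose_injOn ha')]

lemma rep_mem_fixedBy_innerPerms (ha' : Injective a') :
    ∀ β ∈ permsOn (loose a' D), ∀ v ∈ fixedBy ρ (innerPerms a' D),
      ρ β v ∈ fixedBy ρ (innerPerms a' D) := by
  intro β hβ v hv θ hθ
  have : Perm.Disjoint θ β := by
    intro k
    by_cases hk : k ∈ loose a' D
    · exact Or.inl (innerPerm_apply_of_loose ha' hθ hk)
    · exact Or.inr (mem_permsOn.1 hβ k hk)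
  rw [← Module.End.mul_apply, ← map_mul, this.commute.eq, map_mul, Module.End.mul_apply, hv θ hθ]

/-- Shows that the total weight of the sets `B` of size b is, up to a factor independent of b, a
single binomial coefficient, whose convexity in b is accessible. -/
lemma choose_mul_factorials {N s b : ℕ} (hb : b ≤ s) (hs : s ≤ N) :
    s.choose b * ((N - b).factorial * b.factorial) =
      s.factorial * (N - s).factorial * (N - b).choose (N - s) := by
  have h1 := Nat.choose_mul_factorial_mul_factorial hb
  have h2 := Nat.choose_mul_factorial_mul_factorial (show N - s ≤ N - b by omega)
  rw [show N - b - (N - s) = s - b by omega] at h2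
  have h3 := Nat.factorial_pos (s - b)
  apply Nat.eq_of_mul_eq_mul_right h3
  rw [← h1, ← h2]
  ring

/-- The contribution `gapTerm` in terms of the sequence of dimensions. -/
lemma exists_gapTerm_eq (ha' : Injective a')
    (hs : #(splitPairs a' D) ≤ 2 * m - Fintype.card I) :
    ∃ d : ℕ → ℝ, (∀ B ⊆ loose a' D, (invDim ρ (fixedBy ρ (innerPerms a' D)) B : ℝ) = d #B) ∧
      d 0 = Module.finrank ℂ (fixedBy ρ (innerPerms a' D)) ∧ d 1 = d 0 ∧ Antitone d ∧
      (∀ b, 1 ≤ b → 2 * d (b + 1) ≤ d b + d (b + 2)) ∧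
      gapTerm ρ a' D = 2 ^ #(D \ splitPairs a' D) * (((#(splitPairs a' D)).factorial *
        (2 * m - Fintype.card I - #(splitPairs a' D)).factorial : ℕ) : ℝ) *
        ∑ b ∈ range (#(splitPairs a' D) + 1), (-1) ^ b *
          (((2 * m - Fintype.card I - b).choose
            (2 * m - Fintype.card I - #(splitPairs a' D)) : ℝ) *
            ((Module.finrank ℂ V : ℝ) - d b)) := by
  obtain ⟨d, hd, hd0, hd1, hanti, hconv⟩ :=
    exists_dim_sequence (ρ := ρ) (rep_mem_fixedBy_innerPerms (D := D) ha')
  refine ⟨d, hd, hd0, hd1.trans hd0.symm, hanti, hconv, ?_⟩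
  rw [gapTerm, mul_assoc]
  congr 1
  set f : ℕ → ℝ := fun b => (-1) ^ b * ((2 * m - Fintype.card I - b).factorial : ℝ) *
    (b.factorial : ℝ) * ((Module.finrank ℂ V : ℝ) - d b) with hf
  have h1 : ∀ B ∈ (loose a' D).powerset,
      (-1) ^ #B * ((2 * m - Fintype.card I - #B).factorial : ℝ) * ((#B).factorial : ℝ) *
      ((Module.finrank ℂ V : ℝ) - (Module.finrank ℂ
          ↥(fixedBy ρ (innerPerms a' D) ⊓ fixedBy ρ (permsOn B : Set (Perm I))) : ℝ)) = f #B := by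
    intro B hB
    have := hd B (mem_powerset.1 hB)
    rw [invDim] at this
    rw [this]
  rw [sum_congr rfl h1, sum_powerset_apply_card f, card_loose ha', mul_sum]
  refine sum_congr rfl fun b hb => ?_
  have hb : b ≤ #(splitPairs a' D) := by rw [mem_range] at hb; omega
  have h2 := choose_mul_factorials hb hs
  have h3 : ((#(splitPairs a' D)).choose b : ℝ) *
      (((2 * m - Fintype.card I - b).factorial : ℝ) * (b.factorial : ℝ)) =
      (((#(splitPairs a' D)).factorial *
        (2 * m - Fintype.card I - #(splitPairs a' D)).factorial : ℕ) : ℝ) *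
        ((2 * m - Fintype.card I - b).choose
            (2 * m - Fintype.card I - #(splitPairs a' D)) : ℝ) := by exact_mod_cast h2
  rw [nsmul_eq_mul, hf]
  linear_combination (-1) ^ b * ((Module.finrank ℂ V : ℝ) - d b) * h3

lemma choose_sub_antitone (N l : ℕ) : Antitone fun b => ((N - b).choose l : ℝ) :=
  fun a b h => by
    dsimp only
    exact_mod_cast Nat.choose_le_choose l (show N - b ≤ N - a by omega)

lemma choose_sub_convex (N l : ℕ) (hl : 1 ≤ l) (b : ℕ) :
    2 * ((N - (b + 1)).choose l : ℝ) ≤ ((N - b).choose l : ℝ) + ((N - (b + 2)).choose l : ℝ) := by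
  obtain ⟨l, rfl⟩ : ∃ k, l = k + 1 := ⟨l - 1, by omega⟩
  by_cases h2 : b + 2 ≤ N
  · obtain ⟨c, rfl⟩ : ∃ c, N = c + (b + 2) := ⟨N - (b + 2), by omega⟩
    rw [show c + (b + 2) - (b + 1) = c + 1 by omega, show c + (b + 2) - b = c + 2 by omega,
      Nat.add_sub_cancel]
    have h : 2 * (c + 1).choose (l + 1) ≤ (c + 2).choose (l + 1) + c.choose (l + 1) := by
      rw [Nat.choose_succ_succ (c + 1) l, Nat.choose_succ_succ c l]
      have := Nat.choose_le_choose l (Nat.le_succ c)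
      simp only [Nat.succ_eq_add_one] at *
      omega
    exact_mod_cast h
  · rw [show N - (b + 1) = 0 by omega, show N - (b + 2) = 0 by omega]
    simp

/-- A contribution with fewer loose positions than outside points is bounded below by a positive
multiple of the codimension of the inner invariants. -/
theorem le_gapTerm_of_lt (ha' : Injective a')
    (hs : #(splitPairs a' D) < 2 * m - Fintype.card I) :
    2 ^ #(D \ splitPairs a' D) * (((#(splitPairs a' D)).factorial *
      (2 * m - Fintype.card I - #(splitPairs a' D)).factorial : ℕ) : ℝ) *
      ((((2 * m - Fintype.card I).choose (2 * m - Fintype.card I - #(splitPairs a' D)) : ℝ) -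
        ((2 * m - Fintype.card I - 1).choose
          (2 * m - Fintype.card I - #(splitPairs a' D)) : ℝ)) *
      ((Module.finrank ℂ V : ℝ) - (Module.finrank ℂ (fixedBy ρ (innerPerms a' D)) : ℝ))) ≤
      gapTerm ρ a' D := by
  obtain ⟨d, -, hd0, hd1, hanti, hconv, heq⟩ := exists_gapTerm_eq (ρ := ρ) ha' hs.le
  rw [heq, ← hd0]
  refine mul_le_mul_of_nonneg_left ?_ (by positivity)
  set N := 2 * m - Fintype.card I
  set s := #(splitPairs a' D)
  have hz : 0 ≤ (Module.finrank ℂ V : ℝ) - d 0 := by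
    rw [hd0, sub_nonneg]; exact_mod_cast Submodule.finrank_le _
  -- The part constant in b gives the stated lower bound, through the first two terms of an
  -- alternating sum; the part with `d 0 - d b` is nonnegative by convexity.
  have hsplit : ∑ b ∈ range (s + 1), (-1) ^ b * (((N - b).choose (N - s) : ℝ) *
      ((Module.finrank ℂ V : ℝ) - d b)) =
      (∑ b ∈ range (s + 1), (-1) ^ b * ((N - b).choose (N - s) : ℝ)) *
        ((Module.finrank ℂ V : ℝ) - d 0) +
      ∑ b ∈ range (s + 1), (-1) ^ b * (((N - b).choose (N - s) : ℝ) * (d 0 - d b)) := by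
    rw [sum_mul, ← sum_add_distrib]
    exact sum_congr rfl fun b _ => by ring
  have h1 := sub_le_alternating_sum s (choose_sub_antitone N (N - s)) fun k => Nat.cast_nonneg _
  have h2 := alternating_sum_convex_concave_nonneg s (a := fun b => ((N - b).choose (N - s) : ℝ))
    (V := fun b => d 0 - d b) (choose_sub_antitone N (N - s))
    (choose_sub_convex N (N - s) (by omega))
    -- This needs `s < N`: for `s = N` the coefficient would be 1 for every b.
    (fun b hb => by
      rw [Nat.choose_eq_zero_of_lt (by omega)]; simp)
    (sub_self _) (by rw [hd1, sub_self])
    (fun x y h => by linarith [hanti h])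
    (fun b hb => by linarith [hconv b hb])
  rw [hsplit]
  have h3 := mul_le_mul_of_nonneg_right h1 hz
  simp only [Nat.sub_zero] at h3
  linarith

theorem gapTerm_nonneg_of_lt (ha' : Injective a')
    (hs : #(splitPairs a' D) < 2 * m - Fintype.card I) : 0 ≤ gapTerm ρ a' D := by
  refine le_trans ?_ (le_gapTerm_of_lt ha' hs)
  refine mul_nonneg (by positivity) (mul_nonneg (sub_nonneg.2 ?_) (sub_nonneg.2 ?_))
  · exact_mod_cast Nat.choose_le_choose _ (Nat.sub_le _ _)
  · exact_mod_cast Submodule.finrank_le _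

end GapTerm

/-! ### The exceptional case i = m with every pair in D. -/

section HalfCase

set_option linter.unusedSectionVars false

variable {i m : ℕ}
  {V : Type*} [AddCommGroup V] [Module ℂ V] [FiniteDimensional ℂ V]
  {ρ : Representation ℂ (Perm (Fin i)) V} {a' : Fin i → Fin m × Bool}

lemma injective_of_fst (h : Injective fun k => (a' k).1) : Injective a' :=
  Injective.of_comp (f := Prod.fst) h

lemma splitPairs_eq_univ (hi : i = m) (h : Injective fun k => (a' k).1) :
    splitPairs a' univ = univ := by
  subst hi
  ext j
  simp only [mem_univ, iff_true]
  obtain ⟨k, rfl⟩ := (Finite.injective_iff_surjective.1 h) j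
  rw [mem_splitPairs]
  refine ⟨mem_univ _, fun hiff => ?_⟩
  have hk' : a' k = ((a' k).1, (a' k).2) := rfl
  cases hb : (a' k).2
  · rw [hb] at hk'
    obtain ⟨l, hl⟩ := hiff.2 ⟨k, hk'⟩
    have : l = k := h (by dsimp only; rw [hl])
    subst this
    rw [hl] at hb; simp at hb
  · rw [hb] at hk'
    obtain ⟨l, hl⟩ := hiff.1 ⟨k, hk'⟩
    have : l = k := h (by dsimp only; rw [hl])
    subst this
    rw [hl] at hb; simp at hb

lemma fst_injective_of_card_splitPairs (ha' : Injective a') (h : i ≤ #(splitPairs a' univ)) :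
    Injective fun k => (a' k).1 := by
  have h1 : loose a' univ = univ := by
    apply eq_univ_of_card
    rw [Fintype.card_fin]
    refine le_antisymm ?_ (by rwa [card_loose ha'])
    simpa using card_le_univ (loose a' univ)
  have := loose_injOn (D := univ) ha'
  rw [h1] at this
  exact fun x y hxy => this (by simp) (by simp) hxy

lemma fixedBy_innerPerms_eq_top (hi : i = m) (h : Injective fun k => (a' k).1) :
    fixedBy ρ (innerPerms a' univ) = ⊤ := by
  rw [eq_top_iff]
  rintro v - θ ⟨ε, hε, hθ⟩
  rw [splitPairs_eq_univ hi h, sdiff_self] at hε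
  have hε : ε = ∅ := subset_empty.1 hε
  have : θ = 1 := by
    ext k
    have h1 := hθ k
    rw [hε, flip_apply, if_neg (notMem_empty _)] at h1
    rw [injective_of_fst h h1]; rfl
  rw [this, map_one, Module.End.one_apply]

/-- Lower bound for the contribution of positions meeting each pair exactly once. -/
lemma neg_le_gapTerm (hi : i = m) (h : Injective fun k => (a' k).1) {e : ℝ}
    (he : ∀ B : Finset (Fin i), #B = 2 → (invDim ρ ⊤ B : ℝ) = e) :
    -((m.factorial : ℝ) * ((m - 1 : ℕ) : ℝ) * ((Module.finrank ℂ V : ℝ) - e)) ≤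
      gapTerm ρ a' univ := by
  have hs : splitPairs a' univ = univ := splitPairs_eq_univ hi h
  obtain ⟨d, hd, hd0, hd1, hanti, hconv, heq⟩ := exists_gapTerm_eq (ρ := ρ) (D := univ)
    (injective_of_fst h) (by rw [hs]; simp; omega)
  rw [fixedBy_innerPerms_eq_top hi h] at hd hd0
  have hN : 2 * m - i = m := by omega
  -- Here s = N = m, so all the binomial coefficients are 1.
  simp only [hs, sdiff_self, card_univ, Fintype.card_fin, hN, Nat.sub_self, Nat.choose_zero_right,
    bot_eq_empty, card_empty, pow_zero, Nat.factorial_zero, mul_one, one_mul, Nat.cast_one] at heq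
  rw [finrank_top] at hd0
  have hV := neg_le_alternating_sum (V := fun b => (Module.finrank ℂ V : ℝ) - d b)
    (by rw [hd0, sub_self]) (fun x y hxy => by linarith [hanti hxy]) m
  -- By convexity no later decrement of `d` exceeds `d 1 - d 2`, and there are m - 1 decrements
  -- between 1 and m.
  have hlin : ∀ b, (Module.finrank ℂ V : ℝ) - d (b + 1) ≤
      b * ((Module.finrank ℂ V : ℝ) - d 2) ∧
      d (b + 1) - d (b + 2) ≤ (Module.finrank ℂ V : ℝ) - d 2 := by
    intro b
    induction b with
    | zero => simp [hd1, hd0]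
    | succ b ih =>
      have := hconv (b + 1) (by omega)
      have e1 : d (b + 1 + 1) = d (b + 2) := rfl
      have e2 : d (b + 1 + 2) = d (b + 1 + 1 + 1) := rfl
      have e3 : d (b + 1 + 1 + 1) = d (b + 3) := rfl
      push_cast
      constructor <;> linarith [ih.1, ih.2]
  have hbound : (Module.finrank ℂ V : ℝ) - d m ≤
      ((m - 1 : ℕ) : ℝ) * ((Module.finrank ℂ V : ℝ) - e) := by
    rcases Nat.lt_or_ge m 2 with hm | hm
    · have : d m = d 0 := by interval_cases m <;> simp [hd1]
      rw [this, hd0, show m - 1 = 0 by omega]; simp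
    · have hl : loose a' univ = univ := by
        ext k; simp [mem_loose, hs]
      obtain ⟨B, -, hB⟩ := exists_subset_card_eq
        (show 2 ≤ #(univ : Finset (Fin i)) by simp; omega)
      have h2 := hd B (by rw [hl]; exact subset_univ _)
      rw [he B hB, hB] at h2
      have := (hlin (m - 1)).1
      rwa [show m - 1 + 1 = m by omega, ← h2] at this
  rw [heq]
  have hf : (0 : ℝ) ≤ m.factorial := Nat.cast_nonneg _
  have h3 := mul_le_mul_of_nonneg_left (hV.trans' (neg_le_neg hbound)) hf
  linarith

/-- Flipping the pair occupied by j and k is an inner exchange and induces the transposition (j k).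
-/
lemma fixedBy_innerPerms_le {j k : Fin i} (ha' : Injective a')
    (h : a' k = flip univ (a' j)) :
    fixedBy ρ (innerPerms a' univ) ≤ ⊤ ⊓ fixedBy ρ (permsOn {j, k} : Set (Perm (Fin i))) := by
  have hmem : swap j k ∈ innerPerms a' univ := by
    refine ⟨{(a' j).1}, ?_, ?_⟩
    · rw [singleton_subset_iff, mem_sdiff, mem_splitPairs]
      refine ⟨mem_univ _, fun hn => hn.2 ?_⟩
      have hj' : a' j = ((a' j).1, (a' j).2) := rfl
      rw [flip_apply, if_pos (mem_univ _)] at h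
      cases hb : (a' j).2
      · rw [hb] at hj' h; exact iff_of_true ⟨k, h⟩ ⟨j, hj'⟩
      · rw [hb] at hj' h; exact iff_of_true ⟨j, hj'⟩ ⟨k, h⟩
    · intro l
      have hk1 : (a' k).1 = (a' j).1 := by rw [h, flip_apply]
      by_cases hl : (a' l).1 = (a' j).1
      · by_cases hlj : l = j
        · subst hlj
          rw [swap_apply_left, h]
          simp [flip_apply]
        · have h2 : (a' l).2 ≠ (a' j).2 := fun h2 => hlj (ha' (Prod.ext hl h2))
          have hlk : a' l = a' k := by
            rw [h, flip_apply, if_pos (mem_univ _)]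
            refine Prod.ext hl ?_
            cases h3 : (a' l).2 <;> cases h4 : (a' j).2 <;> simp_all
          have := ha' hlk
          subst this
          rw [swap_apply_right, flip_apply, if_pos (by simp [hl]), h, flip_apply]
          simp
      · rw [swap_apply_of_ne_of_ne (fun e => hl (by rw [e])) (fun e => hl (by rw [e, hk1])),
          flip_apply, if_neg (by simpa using hl)]
  intro v hv
  refine ⟨trivial, mem_fixedBy_of_swaps fun x hx y hy => ?_⟩
  simp only [mem_insert, mem_singleton] at hx hy
  rcases hx with rfl | rfl <;> rcases hy with rfl | rfl
  · exact rep_swap_self ρ _ _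
  · exact hv _ hmem
  · rw [swap_comm]; exact hv _ hmem
  · exact rep_swap_self ρ _ _

/-- Lower bound for the contribution of positions containing exactly one pair. -/
lemma le_gapTerm_of_pair (hi : i = m) {j k : Fin i} (hjk : j ≠ k) (ha' : Injective a')
    (h : a' k = flip univ (a' j)) (hs : #(splitPairs a' univ) = m - 2) {e : ℝ}
    (he : ∀ B : Finset (Fin i), #B = 2 → (invDim ρ ⊤ B : ℝ) = e) :
    8 * ((m - 1).factorial : ℝ) * ((Module.finrank ℂ V : ℝ) - e) ≤ gapTerm ρ a' univ := by
  have hm : 2 ≤ m := by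
    have := j.2; have := k.2
    have h3 : j.1 ≠ k.1 := fun h => hjk (Fin.ext h)
    omega
  obtain ⟨c, rfl⟩ : ∃ c, m = c + 2 := ⟨m - 2, by omega⟩
  have hN : 2 * (c + 2) - i = c + 2 := by omega
  have hle := le_gapTerm_of_lt (ρ := ρ) (D := univ) ha' (by rw [hs, Fintype.card_fin]; omega)
  -- The unsplit pairs are the full one and an empty one. The constant is 2² · (m-2)! · 2! · (C(m,2)
  -- - C(m-1,2)) = 8 (m-1)!.
  have hc : #(univ \ splitPairs a' univ) = 2 := by
    rw [card_univ_sdiff, hs, Fintype.card_fin]; omega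
  rw [hc, hs, Fintype.card_fin, hN, show c + 2 - 2 = c by omega, show c + 2 - c = 2 by omega,
    show c + 2 - 1 = c + 1 by omega] at hle
  have hchoose : ((c + 2).choose 2 : ℝ) - ((c + 1).choose 2 : ℝ) = c + 1 := by
    rw [Nat.choose_succ_succ (c + 1) 1]; push_cast; simp
  have hU : (Module.finrank ℂ (fixedBy ρ (innerPerms a' univ)) : ℝ) ≤ e := by
    rw [← he {j, k} (card_pair hjk)]
    exact_mod_cast Submodule.finrank_mono (fixedBy_innerPerms_le ha' h)
  rw [hchoose] at hle
  refine le_trans ?_ hle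
  rw [show c + 2 - 1 = c + 1 by omega, Nat.factorial_succ]
  push_cast
  have hpos : (0 : ℝ) ≤ 8 * c.factorial * (c + 1) := by positivity
  have := mul_le_mul_of_nonneg_left (sub_le_sub_left hU (Module.finrank ℂ V : ℝ)) hpos
  simp only [Nat.factorial_two, Nat.cast_ofNat]
  linarith

/-- The positions meeting each pair at most once. -/
def transversals (i m : ℕ) : Finset (Fin i → Fin m × Bool) := {a' | Injective fun k => (a' k).1}

/-- The positions containing exactly one pair. -/
def onePair (i m : ℕ) : Finset (Fin i → Fin m × Bool) :=
  {a' | Injective a' ∧ #(splitPairs a' univ) = m - 2 ∧ ∃ j k, j ≠ k ∧ a' k = flip univ (a' j)}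

lemma fst_flip (ε : Finset (Fin m)) (x : Fin m × Bool) : (flip ε x).1 = x.1 := rfl

lemma flip_univ_ne (x : Fin m × Bool) : flip univ x ≠ x := by
  intro h
  have := congrArg Prod.snd h
  simp [flip_apply] at this

/-- Moving index k next to index j fills the pair of j and empties the pair of k; all other pairs
stay split. -/
lemma update_flip_mem_onePair (hi : i = m) (h : Injective fun k => (a' k).1) {j k : Fin i}
    (hjk : j ≠ k) : update a' k (flip univ (a' j)) ∈ onePair i m := by
  have hinj : Injective (update a' k (flip univ (a' j))) := by
    intro x y hxy
    by_cases hx : x = k <;> by_cases hy : y = k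
    · rw [hx, hy]
    · subst hx
      rw [update_self, update_of_ne hy] at hxy
      have : j = y := h (by dsimp only; rw [← hxy, fst_flip])
      subst this
      exact absurd hxy (flip_univ_ne _)
    · subst hy
      rw [update_self, update_of_ne hx] at hxy
      have : j = x := h (by dsimp only; rw [hxy, fst_flip])
      subst this
      exact absurd hxy.symm (flip_univ_ne _)
    · rw [update_of_ne hx, update_of_ne hy] at hxy
      exact injective_of_fst h hxy
  have hpair : update a' k (flip univ (a' j)) k =
      flip univ (update a' k (flip univ (a' j)) j) := by
    rw [update_self, update_of_ne hjk]
  have hsplit : splitPairs (update a' k (flip univ (a' j))) univ =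
      univ \ {(a' j).1, (a' k).1} := by
    ext x
    rw [mem_splitPairs, mem_sdiff, mem_insert, mem_singleton]
    simp only [mem_univ, true_and]
    rw [not_iff_not]
    constructor
    · intro hiff
      by_contra hx
      push Not at hx
      subst hi
      obtain ⟨l, hl⟩ := (Finite.injective_iff_surjective.1 h) x
      dsimp only at hl
      have hlj : l ≠ j := fun e => hx.1 (by rw [← hl, e])
      have hlk : l ≠ k := fun e => hx.2 (by rw [← hl, e])
      have key : ∀ b b', a' l = (x, b) → ∀ y, update a' k (flip univ (a' j)) y = (x, b') →
          b = b' := by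
        intro b b' hb y hy
        by_cases hyk : y = k
        · subst hyk
          rw [update_self] at hy
          exact absurd (congrArg Prod.fst hy) (fun e => hx.1 e.symm)
        · rw [update_of_ne hyk] at hy
          have : y = l := h (by dsimp only; rw [hl, hy])
          subst this
          rw [hb] at hy
          exact (Prod.ext_iff.1 hy).2
      have hal : update a' k (flip univ (a' j)) l = (x, (a' l).2) := by
        rw [update_of_ne hlk, ← hl]
      have hal' : a' l = (x, (a' l).2) := by rw [← hl]
      cases hb : (a' l).2
      · rw [hb] at hal hal'
        obtain ⟨y, hy⟩ := hiff.2 ⟨l, hal⟩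
        exact absurd (key _ _ hal' y hy) (by decide)
      · rw [hb] at hal hal'
        obtain ⟨y, hy⟩ := hiff.1 ⟨l, hal⟩
        exact absurd (key _ _ hal' y hy) (by decide)
    · rintro (rfl | rfl)
      · have h1 : update a' k (flip univ (a' j)) j = ((a' j).1, (a' j).2) := by
          rw [update_of_ne hjk]
        have h2 : update a' k (flip univ (a' j)) k = ((a' j).1, !(a' j).2) := by
          rw [update_self, flip_apply, if_pos (mem_univ _)]
        cases hb : (a' j).2
        · rw [hb] at h1 h2; exact iff_of_true ⟨k, h2⟩ ⟨j, h1⟩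
        · rw [hb] at h1 h2; exact iff_of_true ⟨j, h1⟩ ⟨k, h2⟩
      · have hno : ∀ b y, update a' k (flip univ (a' j)) y ≠ ((a' k).1, b) := by
          intro b y hy
          have hy1 := congrArg Prod.fst hy
          by_cases hyk : y = k
          · subst hyk
            rw [update_self, fst_flip] at hy1
            exact hjk (h hy1)
          · rw [update_of_ne hyk] at hy1
            exact hyk (h hy1)
        exact iff_of_false (fun ⟨y, hy⟩ => hno _ y hy) (fun ⟨y, hy⟩ => hno _ y hy)
  simp only [onePair, mem_filter, mem_univ, true_and]
  refine ⟨hinj, ?_, j, k, hjk, hpair⟩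
  rw [hsplit, card_univ_sdiff, Fintype.card_fin, card_pair fun e => hjk (h e)]

lemma eq_of_update_flip (h : Injective fun k => (a' k).1) {j k x y : Fin i}
    (hxy : x ≠ y)
    (hc : update a' k (flip univ (a' j)) y = flip univ (update a' k (flip univ (a' j)) x)) :
    (x = j ∧ y = k) ∨ (x = k ∧ y = j) := by
  have hc1 := congrArg Prod.fst hc
  rw [fst_flip] at hc1
  by_cases hy : y = k
  · subst hy
    rw [update_self, update_of_ne hxy, fst_flip] at hc1
    exact Or.inl ⟨(h hc1).symm, rfl⟩
  · by_cases hx : x = k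
    · subst hx
      rw [update_self, update_of_ne hy, fst_flip] at hc1
      exact Or.inr ⟨rfl, h hc1⟩
    · rw [update_of_ne hx, update_of_ne hy] at hc1
      exact absurd (h hc1).symm hxy

/-- Count the moves of `update_flip_mem_onePair`. The result determines the set {j, k} through its
full pair and the old pair of k through its empty one. Only the order of j and k and the side k came
from remain unknown: at most four sources. -/
lemma card_transversals_le (hi : i = m) :
    m * (m - 1) * #(transversals i m) ≤ 4 * #(onePair i m) := by
  have hcard : #(transversals i m ×ˢ (univ : Finset (Fin i)).offDiag) =
      m * (m - 1) * #(transversals i m) := by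
    rw [card_product, offDiag_card, card_univ, Fintype.card_fin, hi, mul_comm, Nat.mul_sub_one]
  rw [← hcard]
  refine card_le_mul_card_image_of_maps_to
    (f := fun x => update x.1 x.2.2 (flip univ (x.1 x.2.1))) ?_ 4 ?_
  · rintro ⟨a, j, k⟩ hx
    simp only [mem_product, mem_offDiag, transversals, mem_filter, mem_univ,
      true_and] at hx
    exact update_flip_mem_onePair hi hx.1 hx.2
  · intro c _
    rw [show 4 = #(univ : Finset (Bool × Bool)) by rfl]
    refine card_le_card_of_injOn (fun x => (decide (x.2.1 < x.2.2), (x.1 x.2.2).2))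
      (fun _ _ => mem_coe.2 (mem_univ _)) ?_
    rintro ⟨a, j, k⟩ hx ⟨b, j', k'⟩ hy heq
    simp only [coe_filter, mem_product, mem_offDiag, transversals, mem_filter, mem_univ,
      true_and, Set.mem_ofPred_eq] at hx hy
    simp only [Prod.mk.injEq, decide_eq_decide] at heq
    obtain ⟨⟨ha, hjk⟩, hca⟩ := hx
    obtain ⟨⟨hb, hjk'⟩, hcb⟩ := hy
    obtain ⟨hlt, hsnd⟩ := heq
    have hpair : c k' = flip univ (c j') := by
      rw [← hcb, update_self, update_of_ne hjk']
    have hjj : j' = j ∧ k' = k := by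
      rw [← hca] at hpair
      rcases eq_of_update_flip ha hjk' hpair with h | ⟨h1, h2⟩
      · exact h
      · subst h1; subst h2; exfalso
        rcases lt_or_gt_of_ne hjk with h | h
        · exact lt_asymm h (hlt.1 h)
        · exact lt_asymm h (hlt.2 h)
    obtain ⟨rfl, rfl⟩ := hjj
    have hoff : ∀ l, l ≠ k' → a l = b l := fun l hl => by
      have := congrFun (hca.trans hcb.symm) l
      rwa [update_of_ne hl, update_of_ne hl] at this
    have hk : a k' = b k' := by
      refine Prod.ext ?_ hsnd
      subst hi
      obtain ⟨l, hl⟩ := (Finite.injective_iff_surjective.1 ha) (b k').1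
      dsimp only at hl
      by_cases hlk : l = k'
      · rw [hlk] at hl; exact hl
      · rw [hoff l hlk] at hl
        exact absurd (hb hl) hlk
    have : a = b := by
      funext l
      by_cases hl : l = k'
      · rw [hl, hk]
      · exact hoff l hl
    rw [this]

end HalfCase

/-! ### Summing the contributions over all positions. -/

section Total

variable {i m : ℕ} {V : Type*} [AddCommGroup V] [Module ℂ V] [FiniteDimensional ℂ V]

/-- The contributions of a partial matching to the spectral gap add up to a nonnegative number. -/
theorem sum_gapTerm_nonneg (hi : i ≤ m) (ρ : Representation ℂ (Perm (Fin i)) V)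
    (D : Finset (Fin m)) :
    0 ≤ ∑ a' : Fin i → Fin m × Bool with Injective a', gapTerm ρ a' D := by
  -- Only here can s reach 2m - i, since s is at most i ≤ m ≤ 2m - i and at most `#D`.
  by_cases hbad : i = m ∧ D = univ
  · obtain ⟨him, rfl⟩ := hbad
    obtain ⟨d, hd, hd0, -, hanti, -⟩ := exists_dim_sequence (ρ := ρ) (U := ⊤) (J := univ)
      fun _ _ _ _ => trivial
    rw [finrank_top] at hd0
    set v : ℝ := (Module.finrank ℂ V : ℝ) - d 2 with hv
    have hv0 : 0 ≤ v := by
      rw [hv, ← hd0]; linarith [hanti (Nat.zero_le 2)]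
    have he : ∀ B : Finset (Fin i), #B = 2 → (invDim ρ ⊤ B : ℝ) = d 2 := fun B hB => by
      rw [hd B (subset_univ _), hB]
    have hdisj : Disjoint (transversals i m) (onePair i m) := by
      rw [disjoint_left]
      intro a ha hb
      simp only [transversals, onePair, mem_filter, mem_univ, true_and] at ha hb
      obtain ⟨-, -, j, k, hjk, h⟩ := hb
      exact hjk (ha (show (a j).1 = (a k).1 by rw [h, fst_flip]))
    have hsub : transversals i m ∪ onePair i m ⊆
        ({a' | Injective a'} : Finset (Fin i → Fin m × Bool)) := by
      intro a ha
      simp only [transversals, onePair, mem_union, mem_filter, mem_univ, true_and] at ha ⊢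
      rcases ha with ha | ha
      · exact injective_of_fst ha
      · exact ha.1
    have h1 : ∑ a' ∈ transversals i m ∪ onePair i m, gapTerm ρ a' univ ≤
        ∑ a' : Fin i → Fin m × Bool with Injective a', gapTerm ρ a' univ := by
      refine sum_le_sum_of_subset_of_nonneg hsub fun a ha hn => ?_
      have ha := (mem_filter.1 ha).2
      refine gapTerm_nonneg_of_lt ha ?_
      by_contra hlt
      refine hn (mem_union_left _ ?_)
      simp only [transversals, mem_filter, mem_univ, true_and]
      rw [Fintype.card_fin] at hlt
      exact fst_injective_of_card_splitPairs ha (by omega)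
    refine le_trans ?_ h1
    rw [sum_union hdisj]
    have h2 : #(transversals i m) •
        (-((m.factorial : ℝ) * ((m - 1 : ℕ) : ℝ) * v)) ≤
        ∑ a' ∈ transversals i m, gapTerm ρ a' univ := by
      refine card_nsmul_le_sum _ _ _ fun a ha => ?_
      simp only [transversals, mem_filter, mem_univ, true_and] at ha
      exact neg_le_gapTerm him ha he
    have h3 : #(onePair i m) • (8 * ((m - 1).factorial : ℝ) * v) ≤
        ∑ a' ∈ onePair i m, gapTerm ρ a' univ := by
      refine card_nsmul_le_sum _ _ _ fun a ha => ?_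
      simp only [onePair, mem_filter, mem_univ, true_and] at ha
      obtain ⟨ha, hs, j, k, hjk, h⟩ := ha
      exact le_gapTerm_of_pair him hjk ha h hs he
    rw [nsmul_eq_mul] at h2 h3
    rcases Nat.eq_zero_or_pos m with hm | hm
    · have hm' : ((m - 1 : ℕ) : ℝ) = 0 := by simp [hm]
      rw [hm', mul_zero, zero_mul, neg_zero, mul_zero] at h2
      have h30 : (0 : ℝ) ≤ #(onePair i m) * (8 * ((m - 1).factorial : ℝ) * v) := by positivity
      linarith
    -- With m! = m (m-1)!, the deficit is at most 4 (m-1)! v per one-pair position, half of the gain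
    -- 8 (m-1)! v.
    · have h4 : ((m * (m - 1 : ℕ) * #(transversals i m) : ℕ) : ℝ) ≤
          ((4 * #(onePair i m) : ℕ) : ℝ) := by exact_mod_cast card_transversals_le him
      have h5 : (m.factorial : ℝ) = m * (m - 1).factorial := by
        exact_mod_cast (Nat.mul_factorial_pred hm.ne').symm
      push_cast at h4
      rw [h5] at h2
      have h6 : (0 : ℝ) ≤ (m - 1).factorial * v := by positivity
      have h7 := mul_le_mul_of_nonneg_right h4 h6
      have h8 : (0 : ℝ) ≤ #(onePair i m) * ((m - 1).factorial * v) := by positivity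
      linarith
  · refine sum_nonneg fun a ha => ?_
    have ha := (mem_filter.1 ha).2
    refine gapTerm_nonneg_of_lt ha ?_
    rw [Fintype.card_fin]
    by_contra hlt
    have h1 : #(splitPairs a D) ≤ i := by
      rw [← card_loose ha]; simpa using card_le_univ (loose a D)
    have h2 : #(splitPairs a D) ≤ #D := card_le_card fun x hx => (mem_splitPairs.1 hx).1
    have h3 : #D ≤ m := by simpa using card_le_univ D
    refine hbad ⟨by omega, eq_univ_of_card _ ?_⟩
    rw [Fintype.card_fin]; omega

end Total

/-! ### Symmetric functions have the largest eigenvalue. -/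

section SpectralBound

variable {I X : Type*} [DecidableEq I] [Fintype X]

lemma coordRep_mem_harmonic (π : Perm I) {F : (I → X) → ℂ} (hF : F ∈ harmonic I X) :
    coordRep I X π F ∈ harmonic I X := by
  refine ⟨fun a ha => ?_, fun a j => ?_⟩
  · exact hF.1 _ fun h => ha ((Injective.of_comp_iff' a π.bijective).1 h)
  · rw [← hF.2 (a ∘ π) (π.symm j)]
    refine sum_congr rfl fun x _ => ?_
    exact congrArg F (update_comp_equiv a π j x)

/-- Each step of the walk keeps a pair with weight `1 - p` and discards it with weight `p`. -/
def stepWeight (m : ℕ) (p : ℝ) (ε : Finset (Fin m)) : ℂ :=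
  (p : ℂ) ^ (m - #ε) * (1 - (p : ℂ)) ^ #ε

/-- Among the eigenvalues of `avgOp` on harmonic functions, the one on symmetric functions is the
largest. -/
theorem eigenvalue_le_symEigenvalue [DecidableEq X] {i m : ℕ} (hi : i ≤ m)
    (hc : Fintype.card X = 2 * m)
    {p : ℝ} (hp : 1 / 2 ≤ p) (hp1 : p ≤ 1) {F : (Fin i → X) → ℂ} (hF : F ∈ harmonic (Fin i) X)
    (hF0 : F ≠ 0) {ψ : ℂ} (hψ : avgOp (stepWeight m p) F = ψ • F) :
    ψ ≤ symEigenvalue (Fin i) (stepWeight m p) := by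
  -- The whole eigenspace is taken because it must be stable under permuting the coordinates.
  let W : Submodule ℂ ((Fin i → X) → ℂ) :=
    harmonic (Fin i) X ⊓ Module.End.eigenspace (avgOp (stepWeight m p)) ψ
  have hW : ∀ G ∈ W, avgOp (stepWeight m p) G = ψ • G := fun G hG =>
    Module.End.mem_eigenspace_iff.1 hG.2
  have hstab : ∀ π : Perm (Fin i), ∀ G ∈ W, coordRep (Fin i) X π G ∈ W := by
    intro π G hG
    refine ⟨coordRep_mem_harmonic π hG.1, Module.End.mem_eigenspace_iff.2 ?_⟩
    funext a
    exact congrFun (hW G hG) (a ∘ π)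
  let ρ : Representation ℂ (Perm (Fin i)) W :=
    { toFun := fun π => (coordRep (Fin i) X π).restrict (hstab π)
      map_one' := rfl
      map_mul' := fun _ _ => rfl }
  have hmain := symEigenvalue_sub_mul hc (stepWeight m p) W inf_le_left ρ (fun _ _ _ => rfl) ψ hW
  set t : ℝ := ∑ D : Finset (Fin m), (2 * p - 1) ^ (m - #D) * (1 - p) ^ #D *
    ∑ a' : Fin i → Fin m × Bool with Injective a', gapTerm ρ a' D with ht
  -- The weights are nonnegative because 1/2 ≤ p ≤ 1.
  have ht0 : 0 ≤ t := sum_nonneg fun D _ => mul_nonneg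
    (mul_nonneg (pow_nonneg (by linarith) _) (pow_nonneg (by linarith) _))
    (sum_gapTerm_nonneg hi ρ D)
  have hsum : (symEigenvalue (Fin i) (stepWeight m p) - ψ) * (Module.finrank ℂ W : ℂ) = (t : ℂ) := by
    have hper : ∀ a' ∈ ({a' | Injective a'} : Finset (Fin i → Fin m × Bool)),
        ∑ ε, coef (stepWeight m p) a' ε * ∑ θ ∈ completions a' (flip ε ∘ a'),
          ((Module.finrank ℂ W : ℂ) - ρ.character θ) =
        ∑ D : Finset (Fin m), (2 * (p : ℂ) - 1) ^ (m - #D) * (1 - (p : ℂ)) ^ #D *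
          (gapTerm ρ a' D : ℂ) := by
      intro a' ha'
      simp_rw [← sum_powerset_matching ρ (mem_filter.1 ha').2]
      rw [← sum_weight_eq]
      refine sum_congr rfl fun ε _ => ?_
      rw [coef, stepWeight, show 2 * (p : ℂ) - 1 + (1 - p) = p by ring]
      ring
    rw [hmain, sum_congr rfl hper, sum_comm, ht]
    push_cast
    simp_rw [mul_sum]
  have hpos : 0 < Module.finrank ℂ W := by
    have : Nontrivial W := ⟨⟨⟨F, hF, Module.End.mem_eigenspace_iff.2 hψ⟩, 0, fun h =>
      hF0 (congrArg Subtype.val h)⟩⟩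
    exact Module.finrank_pos
  have hne : (Module.finrank ℂ W : ℂ) ≠ 0 := by exact_mod_cast hpos.ne'
  have heq : symEigenvalue (Fin i) (stepWeight m p) - ψ =
      ((t / Module.finrank ℂ W : ℝ) : ℂ) := by
    rw [eq_div_of_mul_eq hne hsum]; push_cast; rfl
  rw [← sub_nonneg, heq]
  exact_mod_cast div_nonneg ht0 (Nat.cast_nonneg _)

end SpectralBound

/-! ### Embedding the Specht module into harmonic functions. -/

section Specht

variable (μ : YoungDiagram)

open Classical in
/-- The sum of the row group in the group algebra. -/
def rowSum : MonoidAlgebra ℂ (Perm (Fin μ.card)) :=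
  ∑ g with g ∈ rowGroup μ, MonoidAlgebra.of ℂ _ g

open Classical in
/-- The signed sum of the column group in the group algebra. -/
def colSum : MonoidAlgebra ℂ (Perm (Fin μ.card)) :=
  ∑ h with h ∈ colGroup μ,
    ((Perm.sign h : ℤ) : ℂ) • MonoidAlgebra.of ℂ (Perm (Fin μ.card)) h

lemma youngSymmetrizer_eq : youngSymmetrizer μ = rowSum μ * colSum μ := rfl

variable {μ}

lemma coeff_mul_of {G : Type*} [Group G] (x : MonoidAlgebra ℂ G) (g h : G) :
    (x * MonoidAlgebra.of ℂ G h).coeff g = x.coeff (g * h⁻¹) := by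
  rw [MonoidAlgebra.of_apply, MonoidAlgebra.coeff_mul_single_eq_coeff_mul (g * h⁻¹), mul_one]
  intro m' _
  exact eq_mul_inv_iff_mul_eq.symm

lemma coeff_of_mul {G : Type*} [Group G] (x : MonoidAlgebra ℂ G) (g h : G) :
    (MonoidAlgebra.of ℂ G h * x).coeff g = x.coeff (h⁻¹ * g) := by
  rw [MonoidAlgebra.of_apply, MonoidAlgebra.coeff_single_mul_eq_mul_coeff (h⁻¹ * g), one_mul]
  intro m' _
  exact eq_inv_mul_iff_mul_eq.symm

open Classical in
lemma coeff_mul_rowSum (x : MonoidAlgebra ℂ (Perm (Fin μ.card))) (g : Perm (Fin μ.card)) :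
    (x * rowSum μ).coeff g = ∑ r with r ∈ rowGroup μ, x.coeff (g * r) := by
  rw [rowSum, mul_sum, MonoidAlgebra.coeff_sum, Finsupp.finsetSum_apply]
  refine sum_nbij' (fun r => r⁻¹) (fun r => r⁻¹) ?_ ?_ ?_ ?_ ?_
  · intro r hr; simpa using hr
  · intro r hr; simpa using hr
  · intro r _; simp
  · intro r _; simp
  · intro r _; rw [coeff_mul_of]

open Classical in
lemma coeff_mul_colSum (x : MonoidAlgebra ℂ (Perm (Fin μ.card))) (g : Perm (Fin μ.card)) :
    (x * colSum μ).coeff g =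
      ∑ h with h ∈ colGroup μ, ((Perm.sign h : ℤ) : ℂ) * x.coeff (g * h⁻¹) := by
  rw [colSum, mul_sum, MonoidAlgebra.coeff_sum, Finsupp.finsetSum_apply]
  refine sum_congr rfl fun h _ => ?_
  rw [mul_smul_comm, MonoidAlgebra.coeff_smul_apply, coeff_mul_of, smul_eq_mul]

lemma coeff_mul_rowSum_mul (x : MonoidAlgebra ℂ (Perm (Fin μ.card))) (g : Perm (Fin μ.card))
    {r : Perm (Fin μ.card)} (hr : r ∈ rowGroup μ) :
    (x * rowSum μ).coeff (g * r) = (x * rowSum μ).coeff g := by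
  classical
  rw [coeff_mul_rowSum, coeff_mul_rowSum]
  refine sum_nbij' (fun s => r * s) (fun s => r⁻¹ * s) ?_ ?_ ?_ ?_ ?_
  · intro s hs
    simp only [mem_filter, mem_univ, true_and] at hs ⊢
    exact mul_mem hr hs
  · intro s hs
    simp only [mem_filter, mem_univ, true_and] at hs ⊢
    exact mul_mem (inv_mem hr) hs
  · intro s _; simp
  · intro s _; simp
  · intro s _; rw [mul_assoc]

lemma sign_mul_self_complex {α : Type*} [DecidableEq α] [Fintype α] (h : Perm α) :
    ((Perm.sign h : ℤ) : ℂ) * ((Perm.sign h : ℤ) : ℂ) = 1 := by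
  rcases Int.units_eq_one_or (Perm.sign h) with e | e <;> simp [e]

lemma coeff_mul_colSum_mul (x : MonoidAlgebra ℂ (Perm (Fin μ.card))) (g : Perm (Fin μ.card))
    {h : Perm (Fin μ.card)} (hh : h ∈ colGroup μ) :
    (x * colSum μ).coeff (g * h) = ((Perm.sign h : ℤ) : ℂ) * (x * colSum μ).coeff g := by
  classical
  rw [coeff_mul_colSum, coeff_mul_colSum, mul_sum]
  refine sum_nbij' (fun s => s * h⁻¹) (fun s => s * h) ?_ ?_ ?_ ?_ ?_
  · intro s hs
    simp only [mem_filter, mem_univ, true_and] at hs ⊢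
    exact mul_mem hs (inv_mem hh)
  · intro s hs
    simp only [mem_filter, mem_univ, true_and] at hs ⊢
    exact mul_mem hs hh
  · intro s _; simp
  · intro s _; simp
  · intro s _
    rw [Perm.sign_mul, Perm.sign_inv, mul_inv_rev, inv_inv, ← mul_assoc g]
    push_cast
    linear_combination (-(((Perm.sign s : ℤ) : ℂ) * x.coeff (g * h * s⁻¹))) *
      sign_mul_self_complex h

/-- Right multiplication by the row sum is injective on the Specht module. -/
lemma eq_zero_of_mul_rowSum_eq_zero {x : MonoidAlgebra ℂ (Perm (Fin μ.card))}
    (hx : x ∈ spechtModule μ) (h : x * rowSum μ = 0) : x = 0 := by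
  classical
  obtain ⟨y, rfl⟩ := Submodule.mem_span_singleton.1 hx
  rw [smul_eq_mul, youngSymmetrizer_eq, ← mul_assoc] at *
  set x := y * rowSum μ * colSum μ with hxdef
  -- Let R be the row sum and q the order of the column group. Both the row sum and the signed
  -- column sum are self-adjoint, and the latter multiplies x by q, so ⟨x, x⟩ = q ⟨yR, x⟩ = q ⟨y,
  -- xR⟩ = 0.
  have h1 : ∑ g, x.coeff g * star (x.coeff g) = 0 := by
    have e1 : ∀ g, x.coeff g * star (x.coeff g) =
        ∑ c with c ∈ colGroup μ, (y * rowSum μ).coeff (g * c⁻¹) * star (x.coeff (g * c⁻¹)) := by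
      intro g
      have e0 : x.coeff g = ∑ c with c ∈ colGroup μ,
          ((Perm.sign c : ℤ) : ℂ) * (y * rowSum μ).coeff (g * c⁻¹) := by
        rw [hxdef, coeff_mul_colSum]
      conv_lhs => enter [1]; rw [e0]
      rw [sum_mul]
      refine sum_congr rfl fun c hc => ?_
      have hc : c⁻¹ ∈ colGroup μ := inv_mem (mem_filter.1 hc).2
      rw [hxdef, coeff_mul_colSum_mul _ g hc, star_mul', Perm.sign_inv]
      simp only [Complex.star_def, map_intCast]
      ring
    have e2 : ∀ c : Perm (Fin μ.card),
        ∑ g, (y * rowSum μ).coeff (g * c⁻¹) * star (x.coeff (g * c⁻¹)) =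
        ∑ g, (y * rowSum μ).coeff g * star (x.coeff g) := fun c =>
      Equiv.sum_comp (Equiv.mulRight c⁻¹) fun g => (y * rowSum μ).coeff g * star (x.coeff g)
    have e3 : ∑ g, (y * rowSum μ).coeff g * star (x.coeff g) = 0 := by
      have e4 : ∀ r : Perm (Fin μ.card), ∑ g, y.coeff (g * r) * star (x.coeff g) =
          ∑ g, y.coeff g * star (x.coeff (g * r⁻¹)) := fun r => by
        rw [← Equiv.sum_comp (Equiv.mulRight r) fun g => y.coeff g * star (x.coeff (g * r⁻¹))]
        exact sum_congr rfl fun g _ => by simp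
      simp_rw [coeff_mul_rowSum, sum_mul]
      rw [sum_comm, sum_congr rfl fun r _ => e4 r, sum_comm]
      refine sum_eq_zero fun g _ => ?_
      have e5 : ∑ r with r ∈ rowGroup μ, x.coeff (g * r⁻¹) = (x * rowSum μ).coeff g := by
        rw [coeff_mul_rowSum]
        refine sum_nbij' (fun r => r⁻¹) (fun r => r⁻¹) ?_ ?_ ?_ ?_ ?_
        · intro r hr; simpa using hr
        · intro r hr; simpa using hr
        · intro r _; simp
        · intro r _; simp
        · intro r _; rfl
      rw [← mul_sum, ← star_sum, e5, h]
      simp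
    rw [sum_congr rfl fun g _ => e1 g, sum_comm, sum_congr rfl fun c _ => e2 c, e3, sum_const_zero]
  have h2 : ∀ g, x.coeff g = 0 := by
    have h3 : ∑ g, Complex.normSq (x.coeff g) = 0 := by
      have : ∀ g, x.coeff g * star (x.coeff g) = (Complex.normSq (x.coeff g) : ℂ) := fun g =>
        Complex.mul_conj _
      simp_rw [this] at h1
      exact_mod_cast h1
    intro g
    exact Complex.normSq_eq_zero.1
      ((sum_eq_zero_iff_of_nonneg fun _ _ => Complex.normSq_nonneg _).1 h3 g (mem_univ g))
  ext g
  exact h2 g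

/-- Only the identity preserves both rows and columns, so the coefficient at 1 is 1. -/
lemma youngSymmetrizer_ne_zero : youngSymmetrizer μ ≠ 0 := by
  classical
  intro h
  have h1 := congrArg (fun x => x.coeff 1) h
  simp only [youngSymmetrizer_eq, coeff_mul_colSum, one_mul] at h1
  have hr : ∀ g : Perm (Fin μ.card), (rowSum μ).coeff g = if g ∈ rowGroup μ then 1 else 0 := by
    intro g
    rw [rowSum, MonoidAlgebra.coeff_sum, Finsupp.finsetSum_apply]
    simp only [MonoidAlgebra.of_apply, MonoidAlgebra.coeff_single, Finsupp.single_apply]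
    rw [sum_ite_eq']
    simp
  have hRC : ∀ g : Perm (Fin μ.card), g ∈ rowGroup μ → g ∈ colGroup μ → g = 1 := by
    intro g hg hg'
    ext k
    have : tableau μ (g k) = tableau μ k := Subtype.ext (Prod.ext (hg k) (hg' k))
    rw [(tableau μ).injective this]; rfl
  rw [sum_eq_single 1] at h1
  · simp [hr, one_mem] at h1
  · intro g hg hne
    rw [hr, if_neg, mul_zero]
    intro hmem
    exact hne (hRC g (inv_mem_iff.1 hmem) (mem_filter.1 hg).2)
  · intro hn; simp [one_mem] at hn

/-- The map from the group algebra to functions of tuples: sum the coefficients of `x * rowSum μ`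
over all permutations with prescribed values at the entries listed by `k`. -/
def tupleMap {i : ℕ} (k : Fin i → Fin μ.card) :
    MonoidAlgebra ℂ (Perm (Fin μ.card)) →ₗ[ℂ] ((Fin i → Fin μ.card) → ℂ) where
  toFun x a := ∑ g with ∀ j, g (k j) = a j, (x * rowSum μ).coeff g
  map_add' x y := by
    funext a
    simp [add_mul, sum_add_distrib]
  map_smul' c x := by
    funext a
    simp [mul_sum]

lemma tupleMap_apply {i : ℕ} (k : Fin i → Fin μ.card)
    (x : MonoidAlgebra ℂ (Perm (Fin μ.card))) (a : Fin i → Fin μ.card) :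
    tupleMap k x a = ∑ g with ∀ j, g (k j) = a j, (x * rowSum μ).coeff g := rfl

lemma tupleMap_of_mul {i : ℕ} (k : Fin i → Fin μ.card) (h : Perm (Fin μ.card))
    (x : MonoidAlgebra ℂ (Perm (Fin μ.card))) (a : Fin i → Fin μ.card) :
    tupleMap k (MonoidAlgebra.of ℂ _ h * x) a = tupleMap k x (h.symm ∘ a) := by
  rw [tupleMap_apply, tupleMap_apply]
  refine sum_nbij' (fun g => h⁻¹ * g) (fun g => h * g) ?_ ?_ ?_ ?_ ?_
  · intro g hg
    simp only [mem_filter, mem_univ, true_and] at hg ⊢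
    intro j; simp [hg j]
  · intro g hg
    simp only [mem_filter, mem_univ, true_and] at hg ⊢
    intro j; simp [hg j]
  · intro g _; simp
  · intro g _; simp
  · intro g _; rw [mul_assoc, coeff_of_mul]

/-- `k` lists the entries outside the first row. -/
def ListsLowerRows {i : ℕ} (k : Fin i → Fin μ.card) : Prop :=
  Injective k ∧ ∀ e, (∃ j, k j = e) ↔ (tableau μ e).1.1 ≠ 0

lemma exists_listsLowerRows (μ : YoungDiagram) {i : ℕ} (hi : μ.rowLen 0 + i = μ.card) :
    ∃ k : Fin i → Fin μ.card, ListsLowerRows k := by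
  have hcard : #{e : Fin μ.card | (tableau μ e).1.1 = 0} = μ.rowLen 0 := by
    rw [YoungDiagram.rowLen_eq_card]
    refine card_bij (fun e _ => (tableau μ e).1) ?_ ?_ ?_
    · intro e he
      rw [YoungDiagram.mem_row_iff]
      exact ⟨(tableau μ e).2, (mem_filter.1 he).2⟩
    · intro e _ e' _ h
      exact (tableau μ).injective (Subtype.ext h)
    · intro c hc
      rw [YoungDiagram.mem_row_iff] at hc
      refine ⟨(tableau μ).symm ⟨c, hc.1⟩, ?_, by simp⟩
      simp [hc.2]
  have hcard' : #{e : Fin μ.card | (tableau μ e).1.1 ≠ 0} = i := by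
    have := card_filter_add_card_filter_not (s := (univ : Finset (Fin μ.card)))
      (fun e => (tableau μ e).1.1 = 0)
    rw [hcard, card_univ, Fintype.card_fin] at this
    have h2 : #{e : Fin μ.card | (tableau μ e).1.1 ≠ 0} =
      #{e : Fin μ.card | ¬ (tableau μ e).1.1 = 0} := rfl
    omega
  let e := (equivFinOfCardEq hcard').symm
  refine ⟨fun j => (e j).1, fun x y h => e.injective (Subtype.ext h), fun x => ⟨?_, fun hx => ?_⟩⟩
  · rintro ⟨j, rfl⟩
    exact (mem_filter.1 (e j).2).2
  · exact ⟨e.symm ⟨x, by simpa using hx⟩, by simp⟩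

variable {i : ℕ} {k : Fin i → Fin μ.card}

/-- Permutations agreeing on the lower entries differ by a row permutation of the first row, under
which `x * rowSum μ` is invariant. Each value of `tupleMap` is thus a positive multiple of one
coefficient or an empty sum. -/
lemma tupleMap_injective (hk : ListsLowerRows k) {x : MonoidAlgebra ℂ (Perm (Fin μ.card))}
    (hx : x ∈ spechtModule μ) (h : tupleMap k x = 0) : x = 0 := by
  refine eq_zero_of_mul_rowSum_eq_zero hx ?_
  ext g
  have h1 := congrFun h (g ∘ k)
  rw [tupleMap_apply] at h1
  have h2 : ∀ g' ∈ ({g' | ∀ j, g' (k j) = (g ∘ k) j} : Finset (Perm (Fin μ.card))),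
      (x * rowSum μ).coeff g' = (x * rowSum μ).coeff g := by
    intro g' hg'
    have hg' := (mem_filter.1 hg').2
    have hfix : ∀ j, (g⁻¹ * g') (k j) = k j := fun j => by
      rw [Perm.mul_apply, hg' j]; simp
    have hmem : g⁻¹ * g' ∈ rowGroup μ := by
      intro e
      by_cases he : ∃ j, k j = e
      · obtain ⟨j, rfl⟩ := he
        rw [hfix]
      · have he' : ¬ ∃ j, k j = (g⁻¹ * g') e := by
          rintro ⟨j, hj⟩
          rw [← hfix j] at hj
          exact he ⟨j, (g⁻¹ * g').injective hj⟩
        rw [hk.2, not_not] at he he'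
        rw [he, he']
    rw [show g' = g * (g⁻¹ * g') by group, coeff_mul_rowSum_mul _ _ hmem]
  rw [sum_congr rfl h2, sum_const, nsmul_eq_mul] at h1
  rcases mul_eq_zero.1 h1 with h3 | h3
  · exfalso
    have : #{g' : Perm (Fin μ.card) | ∀ j, g' (k j) = (g ∘ k) j} = 0 := by exact_mod_cast h3
    rw [card_eq_zero] at this
    exact notMem_empty g (this ▸ mem_filter.2 ⟨mem_univ g, fun _ => rfl⟩)
  · exact h3

/-- Summing over coordinate j frees the image of `k j`. For each row permutation r, the entry r⁻¹(k
j) lies below a first-row entry l of its column, and their transposition changes the sign. Moved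
past r it becomes the transposition of r l and k j, which fixes the other listed entries, so the
terms cancel. -/
lemma tupleMap_mem_harmonic (hk : ListsLowerRows k) {x : MonoidAlgebra ℂ (Perm (Fin μ.card))}
    (hx : x ∈ spechtModule μ) : tupleMap k x ∈ harmonic (Fin i) (Fin μ.card) := by
  classical
  obtain ⟨y, rfl⟩ := Submodule.mem_span_singleton.1 hx
  rw [smul_eq_mul, youngSymmetrizer_eq, ← mul_assoc]
  set w := y * rowSum μ
  refine ⟨fun a ha => ?_, fun a j => ?_⟩
  · rw [tupleMap_apply]
    refine sum_eq_zero fun g hg => absurd ?_ ha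
    have : a = g ∘ k := funext fun j => ((mem_filter.1 hg).2 j).symm
    rw [this]
    exact g.injective.comp hk.1
  · set Q : Finset (Perm (Fin μ.card)) := {g | ∀ l, l ≠ j → g (k l) = a l} with hQ
    have h1 : ∑ v, tupleMap k (w * colSum μ) (update a j v) =
        ∑ g ∈ Q, (w * colSum μ * rowSum μ).coeff g := by
      rw [← sum_fiberwise Q (fun g => g (k j))]
      refine sum_congr rfl fun v _ => ?_
      rw [tupleMap_apply]
      refine sum_congr ?_ fun _ _ => rfl
      ext g
      simp only [hQ, mem_filter, mem_univ, true_and]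
      constructor
      · intro h
        exact ⟨fun l hl => by rw [h l, update_of_ne hl], by rw [h j, update_self]⟩
      · rintro ⟨h, rfl⟩ l
        by_cases hl : l = j
        · subst hl; rw [update_self]
        · rw [h l hl, update_of_ne hl]
    rw [h1]
    simp_rw [coeff_mul_rowSum]
    rw [sum_comm]
    refine sum_eq_zero fun r hr => ?_
    have hr := (mem_filter.1 hr).2
    set k' := r⁻¹ (k j) with hk'
    have hrow' : (tableau μ k').1.1 ≠ 0 := by
      rw [hk', inv_mem hr (k j)]
      exact (hk.2 (k j)).1 ⟨j, rfl⟩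
    have hcell : (0, (tableau μ k').1.2) ∈ μ.cells :=
      μ.isLowerSet (show (0, (tableau μ k').1.2) ≤ (tableau μ k').1 from
        ⟨Nat.zero_le _, le_rfl⟩) (tableau μ k').2
    obtain ⟨l, hl⟩ := (tableau μ).surjective ⟨_, hcell⟩
    have hl0 : (tableau μ l).1.1 = 0 := by rw [hl]
    have hlk : l ≠ k' := fun e => hrow' (by rw [← e, hl0])
    have hswap : swap l k' ∈ colGroup μ := by
      intro e
      by_cases h1 : e = l
      · subst h1; rw [swap_apply_left, hl]
      · by_cases h2 : e = k'
        · rw [h2, swap_apply_right, hl]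
        · rw [swap_apply_of_ne_of_ne h1 h2]
    have hrl : (tableau μ (r l)).1.1 = 0 := by rw [hr l, hl0]
    set τ := swap (r l) (k j) with hτ
    have hτr : ∀ g : Perm (Fin μ.card), g * τ * r = g * r * swap l k' := by
      intro g
      have hrk : r k' = k j := by simp [hk']
      rw [mul_assoc, mul_assoc, mul_swap_eq_swap_mul, hrk]
    have hanti : ∀ g : Perm (Fin μ.card), (w * colSum μ).coeff (g * τ * r) =
        -(w * colSum μ).coeff (g * r) := by
      intro g
      rw [hτr, coeff_mul_colSum_mul _ _ hswap, Perm.sign_swap hlk]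
      simp
    have hfix : ∀ l', l' ≠ j → τ (k l') = k l' := by
      intro l' hl'
      refine swap_apply_of_ne_of_ne (fun e => ?_) (fun e => hl' (hk.1 e))
      exact (hk.2 (k l')).1 ⟨l', rfl⟩ (by rw [e, hrl])
    have hS : ∑ g ∈ Q, (w * colSum μ).coeff (g * r) =
        ∑ g ∈ Q, (w * colSum μ).coeff (g * τ * r) := by
      symm
      refine sum_nbij' (fun g => g * τ) (fun g => g * τ) ?_ ?_ ?_ ?_ ?_
      · intro g hg
        simp only [hQ, mem_filter, mem_univ, true_and] at hg ⊢
        intro l' hl'; rw [Perm.mul_apply, hfix l' hl', hg l' hl']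
      · intro g hg
        simp only [hQ, mem_filter, mem_univ, true_and] at hg ⊢
        intro l' hl'; rw [Perm.mul_apply, hfix l' hl', hg l' hl']
      · intro g _; rw [mul_assoc, swap_mul_self, mul_one]
      · intro g _; rw [mul_assoc, swap_mul_self, mul_one]
      · intro g _; rfl
    simp_rw [hanti, sum_neg_distrib] at hS
    exact self_eq_neg.1 hS

/-- If there is only one row below the first one, then the tuple functions are symmetric. -/
lemma tupleMap_symmetric (hk : ListsLowerRows k)
    (hrow : ∀ e e', (tableau μ e).1.1 ≠ 0 → (tableau μ e').1.1 ≠ 0 →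
      (tableau μ e).1.1 = (tableau μ e').1.1)
    (x : MonoidAlgebra ℂ (Perm (Fin μ.card))) (π : Perm (Fin i)) (a : Fin i → Fin μ.card) :
    tupleMap k x (a ∘ π) = tupleMap k x a := by
  let κ : Fin i ↪ Fin μ.card := ⟨k, hk.1⟩
  have hin : ∀ j, π.viaEmbedding κ (k j) = k (π j) := fun j => π.viaEmbedding_apply κ j
  have hout : ∀ e, (¬ ∃ j, k j = e) → π.viaEmbedding κ e = e := fun e he =>
    π.viaEmbedding_apply_of_notMem κ e he
  have hmem : π.viaEmbedding κ ∈ rowGroup μ := by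
    intro e
    by_cases he : ∃ j, k j = e
    · obtain ⟨j, rfl⟩ := he
      rw [hin]
      exact hrow _ _ ((hk.2 _).1 ⟨_, rfl⟩) ((hk.2 _).1 ⟨_, rfl⟩)
    · rw [hout e he]
  rw [tupleMap_apply, tupleMap_apply]
  symm
  refine sum_nbij' (fun g => g * π.viaEmbedding κ) (fun g => g * (π.viaEmbedding κ)⁻¹)
    ?_ ?_ ?_ ?_ ?_
  · intro g hg
    simp only [mem_filter, mem_univ, true_and] at hg ⊢
    intro j; rw [Perm.mul_apply, hin, hg]; rfl
  · intro g hg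
    simp only [mem_filter, mem_univ, true_and] at hg ⊢
    intro j
    have : (π.viaEmbedding κ)⁻¹ (k j) = k (π⁻¹ j) := by
      rw [Perm.inv_eq_iff_eq, hin]; simp
    rw [Perm.mul_apply, this, hg]; simp
  · intro g _; simp
  · intro g _; simp
  · intro g _; rw [coeff_mul_rowSum_mul _ _ hmem]

end Specht

/-! ### The walk operator, its trace, and comparison with the two-row diagram. -/

section Walk

/-- The bijection numbering the pairs in `Fin m × Bool` consecutively. -/
def pairNumbering {m n : ℕ} (hn : n = 2 * m) : Fin m × Bool ≃ Fin n :=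
  Equiv.ofBijective (fun x => ⟨2 * x.1 + x.2.toNat, by
      have := x.1.2; have := x.2.toNat_lt; omega⟩) <| by
    rw [Fintype.bijective_iff_injective_and_card]
    refine ⟨?_, by simp [hn, mul_comm]⟩
    rintro ⟨j, b⟩ ⟨j', b'⟩ h
    simp only [Fin.mk.injEq] at h
    have h1 := b.toNat_lt
    have h2 := b'.toNat_lt
    have hj : j = j' := Fin.ext (by omega)
    subst hj
    have hb : b.toNat = b'.toNat := by omega
    cases b <;> cases b' <;> simp_all

lemma flip_insert {m : ℕ} {ε : Finset (Fin m)} {j : Fin m} (hj : j ∉ ε) :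
    flip (insert j ε) = flip ε * swap (j, false) (j, true) := by
  ext1 ⟨l, b⟩
  rw [Perm.mul_apply]
  by_cases hl : l = j
  · subst hl
    cases b
    · rw [swap_apply_left]; simp [flip_apply, hj]
    · rw [swap_apply_right]; simp [flip_apply, hj]
  · rw [swap_apply_of_ne_of_ne (by simp [hl]) (by simp [hl])]
    simp [flip_apply, hl]

lemma pairSwaps_eq {m n : ℕ} (hn : n = 2 * m) (s : ℕ) (hs : s ≤ m) :
    pairSwaps n s = (pairNumbering hn).permCongr (flip {j : Fin m | j.1 < s}) := by
  induction s with
  | zero =>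
    ext x
    simp [pairSwaps, flip_apply, Equiv.permCongr_apply]
  | succ s ih =>
    have hset : ({j : Fin m | j.1 < s + 1} : Finset (Fin m)) =
        insert ⟨s, hs⟩ ({j : Fin m | j.1 < s} : Finset (Fin m)) := by
      ext j
      simp only [mem_filter, mem_univ, true_and, mem_insert, Fin.ext_iff]
      omega
    have hmul : ∀ f g : Perm (Fin m × Bool), (pairNumbering hn).permCongr (f * g) =
        (pairNumbering hn).permCongr f * (pairNumbering hn).permCongr g := fun f g => by
      ext x; simp [Equiv.permCongr_apply]
    have hswap : (pairNumbering hn).permCongr (swap (⟨s, hs⟩, false) (⟨s, hs⟩, true)) =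
        swap (⟨2 * s, by omega⟩ : Fin n) ⟨2 * s + 1, by omega⟩ := by
      rw [Equiv.permCongr_def, Equiv.symm_trans_swap_trans]
      congr 1
    rw [hset, flip_insert (by simp), hmul, ← ih (by omega), hswap, pairSwaps, pairSwaps,
      List.range_succ, List.map_append, List.prod_append]
    simp [show 2 * s + 1 < n by omega]

lemma character_pairSwaps {m n : ℕ} (hn : n = 2 * m) {V : Type*} [AddCommGroup V] [Module ℂ V]
    (ρ : Representation ℂ (Perm (Fin n)) V) (ε : Finset (Fin m)) (g : Fin m × Bool ≃ Fin n) :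
    ρ.character (pairSwaps n #ε) = ρ.character (g.permCongr (flip ε)) := by
  have hε : #ε ≤ m := by simpa using card_le_univ ε
  have hcard : #({j : Fin m | j.1 < #ε} : Finset (Fin m)) = #ε := by
    rw [Fin.card_filter_val_lt]; omega
  obtain ⟨π, -, hπ⟩ := exists_perm_image (subset_univ ε)
    (subset_univ ({j : Fin m | j.1 < #ε} : Finset (Fin m))) hcard.symm
  let e : Fin m × Bool ≃ Fin n := (π.prodCongr (Equiv.refl Bool)).trans (pairNumbering hn)
  have h1 : pairSwaps n #ε = e.permCongr (flip ε) := by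
    rw [pairSwaps_eq hn _ hε]
    ext x
    simp only [Equiv.permCongr_apply]
    obtain ⟨y, rfl⟩ := e.surjective x
    rw [Equiv.symm_apply_apply]
    have : (pairNumbering hn).symm (e y) = (π y.1, y.2) := by
      simp only [e, Equiv.trans_apply, Equiv.symm_apply_apply]; rfl
    rw [this]
    have hy := hπ y.1
    simp only [e, Equiv.trans_apply, flip_apply]
    by_cases h : y.1 ∈ ε
    · rw [if_pos (hy.2 h), if_pos h]; rfl
    · rw [if_neg (fun h' => h (hy.1 h')), if_neg h]; rfl
  have h2 : g.permCongr (flip ε) = (e.symm.trans g) * e.permCongr (flip ε) * (e.symm.trans g)⁻¹ := by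
    ext x
    simp [Equiv.permCongr_apply, Perm.mul_apply, Perm.inv_def]
  rw [h1, h2, ρ.char_mul_comm, inv_mul_cancel_left]

/-- The sum over all relabellings of the weighted involutions, acting on the Specht module. -/
def walkOp (μ : YoungDiagram) (m : ℕ) (p : ℝ) : Module.End ℂ (spechtModule μ) :=
  ∑ g : Fin m × Bool ≃ Fin μ.card, ∑ ε, stepWeight m p ε • spechtRep μ (g.permCongr (flip ε))

lemma card_pairings {m n : ℕ} (hn : n = 2 * m) :
    Fintype.card (Fin m × Bool ≃ Fin n) = n.factorial := by
  rw [Fintype.card_equiv (pairNumbering hn)]; simp [hn, mul_comm]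

/-- Characters are class functions, so each of the n! labellings contributes the same trace, with
C(m, s) sets `ε` of size s. -/
lemma eigenvalue_eq_trace {μ : YoungDiagram} {m : ℕ} (hm : μ.card = 2 * m) (p : ℝ) :
    eigenvalue p μ = LinearMap.trace ℂ _ (walkOp μ m p) /
      ((μ.card.factorial : ℂ) * (Module.finrank ℂ (spechtModule μ) : ℂ)) := by
  have htr : LinearMap.trace ℂ _ (walkOp μ m p) = (μ.card.factorial : ℂ) *
      ∑ s ∈ range (m + 1), (p : ℂ) ^ (m - s) * (1 - (p : ℂ)) ^ s * (m.choose s : ℂ) *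
        (spechtRep μ).character (pairSwaps μ.card s) := by
    have h1 : ∀ g : Fin m × Bool ≃ Fin μ.card, LinearMap.trace ℂ _
        (∑ ε, stepWeight m p ε • spechtRep μ (g.permCongr (flip ε))) =
        ∑ s ∈ range (m + 1), (p : ℂ) ^ (m - s) * (1 - (p : ℂ)) ^ s * (m.choose s : ℂ) *
          (spechtRep μ).character (pairSwaps μ.card s) := by
      intro g
      set f : ℕ → ℂ := fun s => (p : ℂ) ^ (m - s) * (1 - (p : ℂ)) ^ s *
        (spechtRep μ).character (pairSwaps μ.card s) with hf
      have h2 := sum_powerset_apply_card f (x := (univ : Finset (Fin m)))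
      rw [powerset_univ, card_univ, Fintype.card_fin] at h2
      rw [map_sum]
      refine (sum_congr rfl fun ε _ => ?_).trans (h2.trans (sum_congr rfl fun s _ => ?_))
      · rw [map_smul, smul_eq_mul, stepWeight, hf]
        dsimp only
        rw [character_pairSwaps hm (spechtRep μ) ε g]; rfl
      · rw [hf, nsmul_eq_mul]; ring
    rw [walkOp, map_sum, sum_congr rfl fun g _ => h1 g, sum_const, card_univ, card_pairings hm,
      nsmul_eq_mul]
  have hfac : (μ.card.factorial : ℂ) ≠ 0 := by exact_mod_cast Nat.factorial_ne_zero _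
  rw [htr, mul_div_mul_left _ _ hfac, eigenvalue, show μ.card / 2 = m by omega, sum_div]
  exact sum_congr rfl fun s _ => by ring

variable {μ : YoungDiagram} {i : ℕ} {k : Fin i → Fin μ.card}

lemma tupleMap_walkOp (m : ℕ) (p : ℝ) (x : spechtModule μ) :
    tupleMap k (walkOp μ m p x).1 = avgOp (stepWeight m p) (tupleMap k x.1) := by
  have h1 : (walkOp μ m p x).1 = ∑ g : Fin m × Bool ≃ Fin μ.card, ∑ ε, stepWeight m p ε •
      (MonoidAlgebra.of ℂ _ (g.permCongr (flip ε)) * x.1) := by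
    simp only [walkOp, LinearMap.sum_apply, LinearMap.smul_apply, Submodule.coe_sum]
    rfl
  funext a
  rw [h1, map_sum, avgOp_apply, Finset.sum_apply]
  refine sum_congr rfl fun g _ => ?_
  rw [map_sum, Finset.sum_apply]
  refine sum_congr rfl fun ε _ => ?_
  rw [map_smul, Pi.smul_apply, smul_eq_mul, tupleMap_of_mul]
  rfl

instance : FiniteDimensional ℂ (spechtModule μ) :=
  Module.Finite.of_injective
    ({ toFun := fun x g => x.1.coeff g
       map_add' := fun _ _ => rfl
       map_smul' := fun _ _ => rfl } : spechtModule μ →ₗ[ℂ] (Perm (Fin μ.card) → ℂ)) (fun x y h => Subtype.ext (by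
        ext g; exact congrFun h g))

/-- The trace is the sum of the roots of the characteristic polynomial. No diagonalizability is
required. -/
lemma trace_le_of_eigenvalue_le {V : Type*} [AddCommGroup V] [Module ℂ V] [FiniteDimensional ℂ V]
    (f : Module.End ℂ V) {α : ℂ} (h : ∀ ψ, f.HasEigenvalue ψ → ψ ≤ α) :
    LinearMap.trace ℂ V f ≤ (Module.finrank ℂ V : ℂ) * α := by
  have hs := IsAlgClosed.splits f.charpoly
  rw [Module.End.trace_eq_sum_roots_charpoly_of_splits hs, ← f.charpoly_natDegree,
    hs.natDegree_eq_card_roots, ← nsmul_eq_mul]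
  refine Multiset.sum_le_card_nsmul _ _ fun ψ hψ => h ψ ?_
  rw [Module.End.hasEigenvalue_iff_isRoot_charpoly]
  exact Polynomial.isRoot_of_mem_roots hψ

lemma finrank_spechtModule_pos : 0 < Module.finrank ℂ (spechtModule μ) := by
  have : Nontrivial (spechtModule μ) := ⟨⟨youngSymmetrizer μ, Ideal.mem_span_singleton_self _⟩, 0,
    fun h => youngSymmetrizer_ne_zero (congrArg Subtype.val h)⟩
  exact Module.finrank_pos

/-- `tupleMap` carries an eigenvector of the walk to a nonzero harmonic eigenvector of `avgOp`, so
every eigenvalue, and with it the trace, obeys the bound for harmonic functions. -/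
theorem eigenvalue_le {m : ℕ} (hm : μ.card = 2 * m) (hi : i ≤ m) (hrow : μ.rowLen 0 + i = μ.card)
    {p : ℝ} (hp : 1 / 2 ≤ p) (hp1 : p ≤ 1) :
    eigenvalue p μ ≤ symEigenvalue (Fin i) (stepWeight m p) / (μ.card.factorial : ℂ) := by
  obtain ⟨k, hk⟩ := exists_listsLowerRows μ hrow
  have htr : LinearMap.trace ℂ _ (walkOp μ m p) ≤
      (Module.finrank ℂ (spechtModule μ) : ℂ) * symEigenvalue (Fin i) (stepWeight m p) := by
    refine trace_le_of_eigenvalue_le _ fun ψ hψ => ?_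
    obtain ⟨x, hx⟩ := hψ.exists_hasEigenvector
    refine eigenvalue_le_symEigenvalue hi (by rw [Fintype.card_fin, hm]) hp hp1
      (tupleMap_mem_harmonic hk x.2) (fun h => hx.2 (Subtype.ext (tupleMap_injective hk x.2 h))) ?_
    rw [← tupleMap_walkOp, hx.apply_eq_smul, ← map_smul]
    rfl
  have hd : (Module.finrank ℂ (spechtModule μ) : ℂ) ≠ 0 := by
    exact_mod_cast finrank_spechtModule_pos.ne'
  have hf : (μ.card.factorial : ℂ) ≠ 0 := by exact_mod_cast Nat.factorial_ne_zero _
  have hpos : (0 : ℂ) ≤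
      ((((μ.card.factorial : ℝ) * (Module.finrank ℂ (spechtModule μ) : ℝ))⁻¹ : ℝ) : ℂ) := by
    rw [Complex.zero_le_real]; positivity
  have h := mul_le_mul_of_nonneg_right htr hpos
  rw [eigenvalue_eq_trace hm]
  push_cast at h
  refine le_of_eq_of_le (div_eq_mul_inv _ _) (h.trans_eq ?_)
  field_simp

/-- The image under `tupleMap` is now symmetric, so the walk operator is a scalar, and that scalar
depends only on n, i and p. -/
theorem eigenvalue_eq {m : ℕ} (hm : μ.card = 2 * m) (hrow : μ.rowLen 0 + i = μ.card)
    (hrow' : ∀ e e', (tableau μ e).1.1 ≠ 0 → (tableau μ e').1.1 ≠ 0 →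
      (tableau μ e).1.1 = (tableau μ e').1.1) (p : ℝ) :
    eigenvalue p μ = symEigenvalue (Fin i) (stepWeight m p) / (μ.card.factorial : ℂ) := by
  obtain ⟨k, hk⟩ := exists_listsLowerRows μ hrow
  have hop : walkOp μ m p = symEigenvalue (Fin i) (stepWeight m p) • LinearMap.id := by
    refine LinearMap.ext fun x => ?_
    have h := avgOp_of_symmetric (by rw [Fintype.card_fin, hm]) (stepWeight m p)
      (tupleMap_mem_harmonic hk x.2) (tupleMap_symmetric hk hrow' x.1)
    rw [← tupleMap_walkOp, ← map_smul, ← sub_eq_zero, ← map_sub] at h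
    have hmem : (walkOp μ m p x).1 - symEigenvalue (Fin i) (stepWeight m p) • x.1 ∈
        spechtModule μ :=
      (walkOp μ m p x - symEigenvalue (Fin i) (stepWeight m p) • x).2
    exact Subtype.ext (sub_eq_zero.1 (tupleMap_injective hk hmem h))
  have hd : (Module.finrank ℂ (spechtModule μ) : ℂ) ≠ 0 := by
    exact_mod_cast finrank_spechtModule_pos.ne'
  rw [eigenvalue_eq_trace hm, hop, map_smul, LinearMap.trace_id, smul_eq_mul,
    mul_div_mul_right _ _ hd]

lemma twoRow_row_eq {a b : ℕ} (h : b ≤ a) (c : ℕ × ℕ) (hc : c ∈ (twoRow a b h).cells)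
    (h0 : c.1 ≠ 0) : c.1 = 1 := by
  obtain ⟨h1, -⟩ := YoungDiagram.mem_ofRowLens.1 ((YoungDiagram.mem_cells _).1 hc)
  simp only [List.length_cons, List.length_nil] at h1
  omega

lemma twoRow_rowLen {a b : ℕ} (h : b ≤ a) : (twoRow a b h).rowLen 0 = a :=
  YoungDiagram.rowLen_ofRowLens (w := [a, b]) ⟨0, by simp⟩

lemma twoRow_card {a b : ℕ} (h : b ≤ a) : (twoRow a b h).card = a + b := by
  have h1 : (twoRow a b h).rowLen 1 = b :=
    YoungDiagram.rowLen_ofRowLens (w := [a, b]) ⟨1, by simp⟩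
  have hcells : (twoRow a b h).cells = (twoRow a b h).row 0 ∪ (twoRow a b h).row 1 := by
    ext c
    rw [mem_union, YoungDiagram.mem_row_iff, YoungDiagram.mem_row_iff, YoungDiagram.mem_cells]
    constructor
    · intro hc
      by_cases h0 : c.1 = 0
      · exact Or.inl ⟨hc, h0⟩
      · exact Or.inr ⟨hc, twoRow_row_eq h c ((YoungDiagram.mem_cells _).2 hc) h0⟩
    · rintro (hc | hc) <;> exact hc.1
  rw [YoungDiagram.card, hcells, card_union_of_disjoint, ← YoungDiagram.rowLen_eq_card,
    ← YoungDiagram.rowLen_eq_card, twoRow_rowLen, h1]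
  rw [disjoint_left]
  intro c hc hc'
  rw [YoungDiagram.mem_row_iff] at hc hc'
  omega

end Walk

end

end InvolutionWalk

/-- The inequality is in the order of `ℂ`: equal imaginary parts, real parts compared. -/
theorem mainTheorem5 (n i : ℕ) (hn : Even n) (hi : 2 * i ≤ n) (p : ℝ) (hp : 1 / 2 ≤ p)
    (hp1 : p ≤ 1) (μ : YoungDiagram) (hμ : μ.card = n) (hrow : μ.rowLen 0 = n - i) :
    InvolutionWalk.eigenvalue p μ ≤
      InvolutionWalk.eigenvalue p (InvolutionWalk.twoRow (n - i) i (by omega)) := by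
  obtain ⟨m, hm⟩ := hn
  have hc := InvolutionWalk.twoRow_card (show i ≤ n - i by omega)
  have hr := InvolutionWalk.twoRow_rowLen (show i ≤ n - i by omega)
  have h1 := InvolutionWalk.eigenvalue_le (μ := μ) (i := i) (m := m) (by omega) (by omega)
    (by omega) hp hp1
  have h2 := InvolutionWalk.eigenvalue_eq (μ := InvolutionWalk.twoRow (n - i) i (by omega))
    (i := i) (m := m) (by omega) (by omega)
    (fun e e' he he' =>
      (InvolutionWalk.twoRow_row_eq _ _ (InvolutionWalk.tableau _ e).2 he).trans
      (InvolutionWalk.twoRow_row_eq _ _ (InvolutionWalk.tableau _ e').2 he').symm) p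
  rw [h2, hc, show n - i + i = μ.card by omega]
  exact h1
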